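/- Let $d\ge 2$, $\omega=e^{2\pi i/d}$, let $\{|i\rangle\}_{i=0}^{d-1}$ be the computational basis of $\mathbb C^d$, and let $X=\sum_i|i+1\rangle\langle i|$ (indices modulo $d$) and $Z=\sum_i\omega^i|i\rangle\langle i|$. Let $\phi_{j,y}\in\mathbb R$ ($j,y\in\{0,\dots,d-1\}$) satisfy $\sum_j\phi_{j,y}=0$ for every $y$, and put $$\gamma^{(n)}_{yk}=\frac1d\,\omega^{kn(n-1)/2}\sum_{l=0}^{d-1}e^{-i\sum_{m=1}^n\phi_{l\oplus m,y}}\,\omega^{knl},\qquad \overline B^{(n)}_y=\sum_{k=0}^{d-1}\bigl(\gamma^{(n)}_{yk}\bigr)^*(XZ^k)^n,\qquad \overline B_y=\overline B^{(1)}_y,$$ where $\oplus$ is addition modulo $d$. Assume that $\sum_{k}\bigl(\gamma^{(n)}_{y'k}\bigr)^*\gamma^{(n)}_{yk}=\delta_{yy'}$ for all $y,y'$ and all $n=1,\dots,d-1$. Let $\mathcal H_B$ be a complex Hilbert space of any dimension and $\rho_{AB}$ a (possibly mixed) state on $\mathbb C^d\otimes\mathcal H_B$ whose reduced state $\rho_B=\mathrm{Tr}_A\,\rho_{AB}$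 has full support, i.e. trivial kernel. For $y=0,\dots,d-1$ let $N_y=\{N_{b|y}\}_{b=0}^{d-1}$ be a (not necessarily projective) POVM on $\mathcal H_B$, with generalized observables $B_{n|y}=\sum_b\omega^{bn}N_{b|y}$, and write $B_y=B_{1|y}$. Alice's trusted observables are $A_k=XZ^{-k}$. Suppose that the steering functional attains its maximal quantum value $d(d-1)$: $$\sum_{n=1}^{d-1}\sum_{k,y=0}^{d-1}\gamma^{(n)}_{yk}\,\mathrm{Tr}\bigl[\rho_{AB}\,(A_k^n\otimes B_{n|y})\bigr]=d(d-1).$$ Then: (i) Bob's measurements are projective: every $N_{b|y}$ is an orthogonal projection, and every $B_{n|y}$ ($1\le n\le d-1$) is unitary with $B_{n|y}^d=\mathbb 1$. (ii) Bob's space decomposes as $\mathcal H_B\cong\mathbb C^d\otimes\mathcal H_{B''}$ for some Hilbert space $\mathcal H_{B''}$. (iii) There are a unitary $U_B:\mathcal H_B\to\mathbb C^d\otimes\mathcal H_{B''}$ and a state $\rho_{B''}$ on $\mathcal H_{B''}$ such that, with $|\phi_d^+\rangle=\frac1{\sqrt d}\sum_i|ii\rangle$, $$(\mathbb 1\otimes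 U_B)\,\rho_{AB}\,(\mathbb 1\otimes U_B^\dagger)=|\phi_d^+\rangle\langle\phi_d^+|\otimes\rho_{B''},\qquad U_BB_yU_B^\dagger=\overline B_y\otimes\mathbb 1_{B''}\quad\text{for every }y.$$ -/

import Mathlib

open scoped TensorProduct ComplexConjugate

universe u

noncomputable section

namespace Steering

/-- The `d`-dimensional space `ℂ^d` with its Hermitian inner product. -/
abbrev Qudit (d : ℕ) : Type := EuclideanSpace ℂ (Fin d)

/-- The computational basis vector `|i⟩`. -/
def ket {d : ℕ} (i : Fin d) : Qudit d := EuclideanSpace.single i 1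

/-- `ω = exp(2πi/d)`. -/
def omega (d : ℕ) : ℂ := Complex.exp (2 * Real.pi * Complex.I / d)

/-- The shift `X = ∑ᵢ |i+1⟩⟨i|`, with `i + 1` taken modulo `d`. -/
def shiftX (d : ℕ) [NeZero d] : Matrix (Fin d) (Fin d) ℂ :=
  Matrix.of fun i j => if i = j + 1 then 1 else 0

/-- The clock `Z = ∑ᵢ ωⁱ |i⟩⟨i|`. -/
def clockZ (d : ℕ) : Matrix (Fin d) (Fin d) ℂ :=
  Matrix.diagonal fun i => omega d ^ (i : ℕ)

/-- Alice's observables `A_k = X Z⁻ᵏ`. -/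
def aliceObs (d : ℕ) [NeZero d] (k : Fin d) : Matrix (Fin d) (Fin d) ℂ :=
  shiftX d * ((clockZ d)⁻¹) ^ (k : ℕ)

/-- The coefficients
`γ_{yk}^{(n)} = (1/d) ω^{k n(n-1)/2} ∑_l exp(-i ∑_{m=1}^n φ_{l⊕m,y}) ω^{k n l}`;
here `φ j y` stands for `φ_{j,y}` and `⊕` is the addition of `Fin d`. -/
def gamma {d : ℕ} [NeZero d] (φ : Fin d → Fin d → ℝ) (n : ℕ) (y k : Fin d) : ℂ :=
  (1 / (d : ℂ)) * omega d ^ ((k : ℕ) * (n * (n - 1) / 2)) *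
    ∑ l : Fin d,
      Complex.exp (-Complex.I * ((∑ m ∈ Finset.Icc 1 n, φ (l + Fin.ofNat d m) y : ℝ) : ℂ)) *
        omega d ^ ((k : ℕ) * n * (l : ℕ))

/-- The reference operators `B̄_y^{(n)} = ∑_k (γ_{yk}^{(n)})^* (X Zᵏ)ⁿ`. -/
def refObs {d : ℕ} [NeZero d] (φ : Fin d → Fin d → ℝ) (n : ℕ) (y : Fin d) :
    Matrix (Fin d) (Fin d) ℂ :=
  ∑ k : Fin d, conj (gamma φ n y k) • (shiftX d * clockZ d ^ (k : ℕ)) ^ n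

/-- The maximally entangled vector `|φ_d^+⟩ = d^{-1/2} ∑ᵢ |i⟩ ⊗ |i⟩`. -/
def maxEntangled (d : ℕ) : Qudit d ⊗[ℂ] Qudit d :=
  ((1 / Real.sqrt d : ℝ) : ℂ) • ∑ i : Fin d, ket i ⊗ₜ[ℂ] ket i

/-- `T` has trace `t`: in every orthonormal (Hilbert) basis the diagonal entries of `T` sum
(unconditionally) to `t`. -/
def HasTrace {E : Type u} [NormedAddCommGroup E] [InnerProductSpace ℂ E]
    (T : E →ₗ[ℂ] E) (t : ℂ) : Prop :=
  ∀ (ι : Type u) (b : HilbertBasis ι ℂ E), HasSum (fun i => inner ℂ (b i) (T (b i))) t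

/-- Density operators: positive operators of trace one. -/
def IsDensityOperator {E : Type u} [NormedAddCommGroup E] [InnerProductSpace ℂ E]
    (ρ : E →L[ℂ] E) : Prop :=
  ρ.IsPositive ∧ HasTrace (ρ : E →ₗ[ℂ] E) 1

/-- A measurement with outcomes `0, …, d-1`: positive operators that sum to the identity. -/
def IsPOVM {d : ℕ} {H : Type u} [NormedAddCommGroup H] [InnerProductSpace ℂ H]
    (N : Fin d → H →L[ℂ] H) : Prop :=
  (∀ b, (N b).IsPositive) ∧ ∑ b, N b = 1

/-- The generalized observables of a measurement, `B_n = ∑_b ω^{bn} N_b`. -/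
def genObs {d : ℕ} {H : Type u} [NormedAddCommGroup H] [InnerProductSpace ℂ H]
    (N : Fin d → H →L[ℂ] H) (n : ℕ) : H →L[ℂ] H :=
  ∑ b : Fin d, omega d ^ ((b : ℕ) * n) • N b

/-- `B̃_k^{(n)} = ∑_y γ_{yk}^{(n)} B_{n|y}`. -/
def tildeObs {d : ℕ} [NeZero d] {H : Type u} [NormedAddCommGroup H] [InnerProductSpace ℂ H]
    (φ : Fin d → Fin d → ℝ) (N : Fin d → Fin d → H →L[ℂ] H) (n : ℕ) (k : Fin d) : H →L[ℂ] H :=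
  ∑ y : Fin d, gamma φ n y k • genObs (N y) n

/-- The steering operator `𝓢 = ∑_{n=1}^{d-1} ∑_k A_kⁿ ⊗ B̃_k^{(n)}` on `ℂ^d ⊗ H`. -/
def steeringOp {d : ℕ} [NeZero d] {H : Type u} [NormedAddCommGroup H] [InnerProductSpace ℂ H]
    (φ : Fin d → Fin d → ℝ) (N : Fin d → Fin d → H →L[ℂ] H) :
    (Qudit d ⊗[ℂ] H) →ₗ[ℂ] (Qudit d ⊗[ℂ] H) :=
  ∑ n ∈ Finset.Icc 1 (d - 1), ∑ k : Fin d,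
    TensorProduct.map (Matrix.toEuclideanLin (aliceObs d k ^ n))
      (tildeObs φ N n k : H →ₗ[ℂ] H)

/-- Bob's reduced state `ρ_B = Tr_A ρ = ∑ᵢ (⟨i| ⊗ 1) ρ (|i⟩ ⊗ 1)`. -/
def bobState {d : ℕ} {H : Type u} [NormedAddCommGroup H] [InnerProductSpace ℂ H]
    (ρ : (Qudit d ⊗[ℂ] H) →L[ℂ] (Qudit d ⊗[ℂ] H)) : H →ₗ[ℂ] H :=
  ∑ i : Fin d,
    ((TensorProduct.lid ℂ H).toLinearMap ∘ₗ
        LinearMap.rTensor H (innerSL ℂ (ket i) : Qudit d →ₗ[ℂ] ℂ)) ∘ₗ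
      (ρ : (Qudit d ⊗[ℂ] H) →ₗ[ℂ] (Qudit d ⊗[ℂ] H)) ∘ₗ
        TensorProduct.mk ℂ (Qudit d) H (ket i)

end Steering

end

/-!
The argument is a sum of squares followed by the reconstruction of a matrix algebra.

For a vector `ψ` of `ℂ^d ⊗ H` and an exponent `n`, orthonormality of the rows of `γ^{(n)}` gives
`∑_k ‖(1 ⊗ B̃_k^{(n)}) ψ‖² = ∑_y ‖(1 ⊗ B_{n|y}) ψ‖² ≤ d ‖ψ‖²`, while `A_kⁿ` is unitary; expanding
`∑_k ‖((A_kⁿ)† ⊗ 1) ψ - (1 ⊗ B̃_k^{(n)}) ψ‖² ≥ 0` bounds the contribution of `n` by `d ‖ψ‖²`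
(`two_mul_sum_re_inner_eq`, `sum_re_inner_le`). Writing `ρ = R²` with `R` self-adjoint, cyclicity
of the trace (`hasSum_inner_conj`) makes the value of the functional a sum over the vectors
`R b_i`, for a Hilbert basis `b`, so that each of them saturates the bound. The terms with `n = 1`
then give, on the range of `ρ` (`relations_of_hasTrace`),

* `1 ⊗ B̃_k = A_k† ⊗ 1`, and
* `N_{b|y} (ω^b - B_y) = 0` on Bob's side, from `1 - B†B = ∑_b (ω^b - B)† N_b (ω^b - B)`.

As `ρ_B` has trivial kernel, a bounded operator `T` with `(1 ⊗ T) ρ = 0` vanishes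
(`Transfers.unique`). Hence `N_b B = ω^b N_b` on all of `H`; this forces `B_n = Bⁿ`, `B^d = 1`,
unitarity of `B`, and orthogonality of the effects, which is part (i).

For the rest, say that a matrix `M` is transferred to `T` when `(1 ⊗ T) ρ = (Mᵀ ⊗ 1) ρ`. The
transfer is multiplicative, and `X Zᵏ`, the complex conjugate of `A_k`, is transferred to `B̃_k`.
By inversion of `γ`, the reference observable `B̄_y` is transferred to `B_y`; both are unitary, so
their adjoints correspond as well (`Transfers.star_of_unitary`). The pairs for which `M` and `M†`
are transferred form a star-algebra (`transferAlgebra`) whose first components contain all `X Zᵏ`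
and thus all matrices (`exists_transfer_single`). The images `e_{ij}` of the matrix units are
matrix units on `H`, and `v ↦ ∑ᵢ |i⟩ ⊗ e_{0i} v` is the unitary `U_B : H → ℂ^d ⊗ e_{00} H`. It
carries `B_y = ∑ (B̄_y)_{ij} e_{ij}` to `B̄_y ⊗ 1`, and the relation
`(1 ⊗ e_{ab}) ρ = (|b⟩⟨a| ⊗ 1) ρ` leaves for the state only `|φ_d^+⟩⟨φ_d^+| ⊗ σ`.
-/

namespace Steering

/-! ### Coordinates on `ℂ^d ⊗ H` -/

section Coordinates

variable {d : ℕ} {H : Type u} [NormedAddCommGroup H] [InnerProductSpace ℂ H]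

theorem ket_apply (i j : Fin d) : (ket i : Qudit d) j = if j = i then 1 else 0 := by
  simp [ket]

theorem inner_ket_left (i : Fin d) (x : Qudit d) : inner ℂ (ket i) x = x i := by
  simp [ket, EuclideanSpace.inner_single_left]

theorem inner_ket_ket (i j : Fin d) :
    inner ℂ (ket i : Qudit d) (ket j) = if i = j then 1 else 0 := by
  rw [inner_ket_left, ket_apply]

theorem sum_smul_ket (x : Qudit d) : ∑ i, x i • ket i = x := by
  ext j
  simp [ket_apply]

theorem toEuclideanLin_ket (A : Matrix (Fin d) (Fin d) ℂ) (j : Fin d) :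
    Matrix.toEuclideanLin A (ket j) = ∑ i, A i j • ket i := by
  ext i
  simp [ket, Matrix.toEuclideanLin, Matrix.toLpLin_apply, Pi.single_apply]

/-- The contraction `⟨i| ⊗ 1 : ℂ^d ⊗ H → H`, which reads off the `i`-th coordinate of a vector of
`ℂ^d ⊗ H ≅ H^d`. -/
noncomputable def coord (i : Fin d) : (Qudit d ⊗[ℂ] H) →L[ℂ] H :=
  (TensorProduct.lidIsometry ℂ H : (ℂ ⊗[ℂ] H) →L[ℂ] H) ∘L
    (innerSL ℂ (ket i : Qudit d)).rTensor H

@[simp] theorem coord_tmul (i : Fin d) (x : Qudit d) (v : H) : coord i (x ⊗ₜ[ℂ] v) = x i • v := by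
  simp [coord, inner_ket_left]

theorem sum_ket_tmul_coord (ψ : Qudit d ⊗[ℂ] H) : ∑ i, ket i ⊗ₜ[ℂ] coord i ψ = ψ := by
  induction ψ using TensorProduct.induction_on with
  | zero => simp
  | tmul x v =>
    simp_rw [coord_tmul, ← TensorProduct.smul_tmul, ← TensorProduct.sum_tmul, sum_smul_ket]
  | add a b ha hb => simp only [map_add, TensorProduct.tmul_add, Finset.sum_add_distrib, ha, hb]

theorem coord_ket_tmul (i j : Fin d) (v : H) :
    coord i (ket j ⊗ₜ[ℂ] v) = if i = j then v else 0 := by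
  simp [ket_apply]

theorem ext_coord {ψ χ : Qudit d ⊗[ℂ] H} (h : ∀ i, coord i ψ = coord i χ) : ψ = χ := by
  rw [← sum_ket_tmul_coord ψ, ← sum_ket_tmul_coord χ]
  simp [h]

theorem linearMap_ext_ket {V : Type*} [AddCommGroup V] [Module ℂ V]
    {f g : (Qudit d ⊗[ℂ] H) →ₗ[ℂ] V} (h : ∀ i v, f (ket i ⊗ₜ[ℂ] v) = g (ket i ⊗ₜ[ℂ] v)) :
    f = g :=
  LinearMap.ext fun ψ => by
    rw [← sum_ket_tmul_coord ψ, map_sum, map_sum]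
    exact Finset.sum_congr rfl fun i _ => h i _

theorem coord_sum_ket_tmul (i : Fin d) (v : Fin d → H) :
    coord i (∑ j, ket j ⊗ₜ[ℂ] v j) = v i := by
  simp [ket_apply]

theorem inner_eq_sum_coord (ψ χ : Qudit d ⊗[ℂ] H) :
    inner ℂ ψ χ = ∑ i, inner ℂ (coord i ψ) (coord i χ) := by
  conv_lhs => rw [← sum_ket_tmul_coord ψ, ← sum_ket_tmul_coord χ]
  simp [sum_inner, inner_sum, inner_ket_ket]

theorem inner_ket_tmul_left (i : Fin d) (v : H) (ψ : Qudit d ⊗[ℂ] H) :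
    inner ℂ (ket i ⊗ₜ[ℂ] v) ψ = inner ℂ v (coord i ψ) := by
  rw [inner_eq_sum_coord, Finset.sum_eq_single i] <;> simp +contextual [ket_apply]

theorem norm_sq_eq_sum_coord (ψ : Qudit d ⊗[ℂ] H) : ‖ψ‖ ^ 2 = ∑ i, ‖coord i ψ‖ ^ 2 := by
  rw [← inner_self_eq_norm_sq (𝕜 := ℂ), inner_eq_sum_coord, map_sum]
  simp_rw [inner_self_eq_norm_sq]

theorem coord_map (A : Matrix (Fin d) (Fin d) ℂ) (T : H →ₗ[ℂ] H) (i : Fin d)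
    (ψ : Qudit d ⊗[ℂ] H) :
    coord i (TensorProduct.map (Matrix.toEuclideanLin A) T ψ) = ∑ j, A i j • T (coord j ψ) := by
  conv_lhs => rw [← sum_ket_tmul_coord ψ]
  simp [toEuclideanLin_ket, ket_apply]

theorem inner_maxEntangled_ket_tmul_ket (i a : Fin d) :
    inner ℂ (maxEntangled d) (ket i ⊗ₜ[ℂ] ket a) =
      if a = i then ((1 / Real.sqrt d : ℝ) : ℂ) else 0 := by
  refine (inner_smul_left (𝕜 := ℂ) (E := Qudit d ⊗[ℂ] Qudit d) _ _ _).trans ?_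
  rw [Complex.conj_ofReal, sum_inner]
  simp [inner_ket_ket]

theorem assoc_maxEntangled_tmul {K : Type*} [AddCommGroup K] [Module ℂ K] (v : K) :
    TensorProduct.assoc ℂ (Qudit d) (Qudit d) K (maxEntangled d ⊗ₜ[ℂ] v) =
      ((1 / Real.sqrt d : ℝ) : ℂ) • ∑ i, ket i ⊗ₜ[ℂ] (ket i ⊗ₜ[ℂ] v) := by
  rw [maxEntangled, ← TensorProduct.smul_tmul', map_smul, TensorProduct.sum_tmul, map_sum]
  simp

/-- The coordinates identify `ℂ^d ⊗ H` with the complete space `H^d`. -/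
theorem completeSpace_qudit_tmul [CompleteSpace H] : CompleteSpace (Qudit d ⊗[ℂ] H) := by
  let e : (Qudit d ⊗[ℂ] H) ≃L[ℂ] (Fin d → H) :=
    { toFun := fun ψ i => coord i ψ
      invFun := fun v => ∑ i, ket i ⊗ₜ[ℂ] v i
      map_add' := fun _ _ => by ext; simp
      map_smul' := fun _ _ => by ext; simp
      left_inv := sum_ket_tmul_coord
      right_inv := fun v => by ext i; exact coord_sum_ket_tmul i v
      continuous_toFun := by fun_prop
      continuous_invFun := by fun_prop }
  exact (completeSpace_congr (e := e.toEquiv) e.isUniformEmbedding).2 inferInstance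

/-- The vectors `|i⟩ ⊗ b j` form a Hilbert basis when the `b j` do. -/
theorem exists_hilbertBasis_tmul [CompleteSpace H] {ι : Type*} (b : HilbertBasis ι ℂ H) :
    ∃ c : HilbertBasis (Fin d × ι) ℂ (Qudit d ⊗[ℂ] H), ∀ p, c p = ket p.1 ⊗ₜ[ℂ] b p.2 := by
  classical
  have := completeSpace_qudit_tmul (d := d) (H := H)
  have ho : Orthonormal ℂ (fun p : Fin d × ι => ket p.1 ⊗ₜ[ℂ] b p.2) := by
    rw [orthonormal_iff_ite]
    rintro ⟨i, j⟩ ⟨i', j'⟩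
    simp only [TensorProduct.inner_tmul, inner_ket_ket, Prod.mk.injEq,
      orthonormal_iff_ite.1 b.orthonormal j j']
    split_ifs <;> simp_all
  refine ⟨HilbertBasis.mkOfOrthogonalEqBot ho ?_, fun p => ?_⟩
  · rw [Submodule.eq_bot_iff]
    intro ψ hψ
    rw [Submodule.mem_orthogonal] at hψ
    refine ext_coord fun i => ?_
    rw [map_zero]
    apply b.repr.injective
    ext j
    rw [b.repr_apply_apply, map_zero, ← inner_ket_tmul_left]
    exact hψ _ (Submodule.subset_span ⟨(i, j), rfl⟩)
  · rw [HilbertBasis.coe_mkOfOrthogonalEqBot]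

end Coordinates

/-! ### Traces -/

section Trace

variable {E : Type*} [NormedAddCommGroup E] [InnerProductSpace ℂ E] [CompleteSpace E]

/-- Cyclicity of the trace, `tr (R² S) = tr (R S R)`, for a self-adjoint Hilbert–Schmidt operator
`R` and a bounded operator `S`: both sides are sums of one absolutely summable double family. -/
theorem hasSum_inner_conj {ι : Type*} (b : HilbertBasis ι ℂ E) {R : E →L[ℂ] E}
    (hR : IsSelfAdjoint R) (S : E →L[ℂ] E) (hs : Summable fun i => ‖R (b i)‖ ^ 2) {t : ℂ}
    (ht : HasSum (fun i => inner ℂ (b i) (R (R (S (b i))))) t) :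
    HasSum (fun i => inner ℂ (R (b i)) (S (R (b i)))) t := by
  have hRs : ∀ x y, inner ℂ (R x) y = inner ℂ x (R y) := fun x y => hR.isSymmetric x y
  let F : ι × ι → ℂ := fun p =>
    inner ℂ (S.adjoint (R (b p.1))) (b p.2) * inner ℂ (b p.2) (R (b p.1))
  have hsq : ∀ x : E, HasSum (fun i => ‖inner ℂ (b i) x‖ ^ 2) (‖x‖ ^ 2) := fun x => by
    have h := b.hasSum_inner_mul_inner x x
    have h2 := Complex.hasSum_re h
    convert h2 using 1
    · ext i
      rw [← inner_conj_symm x, ← Complex.normSq_eq_conj_mul_self, Complex.ofReal_re,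
        Complex.normSq_eq_norm_sq]
    · exact (inner_self_eq_norm_sq (𝕜 := ℂ) x).symm
  have hbound : ∀ x : E, ‖S.adjoint x‖ ^ 2 ≤ ‖S.adjoint‖ ^ 2 * ‖x‖ ^ 2 := fun x => by
    rw [← mul_pow]
    gcongr
    exact S.adjoint.le_opNorm x
  have hG : Summable fun p : ι × ι =>
      ‖inner ℂ (b p.2) (S.adjoint (R (b p.1)))‖ ^ 2 + ‖inner ℂ (b p.2) (R (b p.1))‖ ^ 2 := by
    rw [summable_prod_of_nonneg (fun p => by positivity)]
    have hrow := fun i => (hsq (S.adjoint (R (b i)))).add (hsq (R (b i)))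
    refine ⟨fun i => (hrow i).summable, ?_⟩
    refine Summable.of_nonneg_of_le (fun i => tsum_nonneg fun j => by positivity) (fun i => ?_)
      (hs.mul_left (‖S.adjoint‖ ^ 2 + 1))
    rw [(hrow i).tsum_eq]
    linarith [hbound (R (b i))]
  have hF : Summable F := by
    refine Summable.of_norm_bounded hG fun p => ?_
    simp only [F, norm_mul]
    rw [norm_inner_symm]
    nlinarith [sq_nonneg (‖inner ℂ (b p.2) (S.adjoint (R (b p.1)))‖ -
      ‖inner ℂ (b p.2) (R (b p.1))‖), sq_nonneg ‖inner ℂ (b p.2) (S.adjoint (R (b p.1)))‖,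
      sq_nonneg ‖inner ℂ (b p.2) (R (b p.1))‖]
  have hrow : ∀ i, HasSum (fun j => F (i, j)) (inner ℂ (R (b i)) (S (R (b i)))) := fun i => by
    have := b.hasSum_inner_mul_inner (S.adjoint (R (b i))) (R (b i))
    rwa [ContinuousLinearMap.adjoint_inner_left] at this
  have hcol : ∀ j, HasSum (fun i => F (i, j)) (inner ℂ (b j) (R (R (S (b j))))) := fun j => by
    have := b.hasSum_inner_mul_inner (R (b j)) (R (S (b j)))
    rw [hRs] at this
    refine (funext fun i => ?_ : (fun i => F (i, j)) = _) ▸ this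
    simp only [F]
    rw [ContinuousLinearMap.adjoint_inner_left, hRs, ← hRs (b j), mul_comm]
  have h1 := hF.hasSum.prod_fiberwise hrow
  have h2 := ((Equiv.prodComm ι ι).hasSum_iff.2 hF.hasSum).prod_fiberwise hcol
  rwa [h2.unique ht] at h1

end Trace

/-! ### Roots of unity, clock and shift -/

section Matrices

variable {d : ℕ}

theorem diagonal_mem_unitary {v : Fin d → ℂ} (h : ∀ i, v i * conj (v i) = 1) :
    Matrix.diagonal v ∈ Matrix.unitaryGroup (Fin d) ℂ := by
  rw [Matrix.mem_unitaryGroup_iff, Matrix.star_eq_conjTranspose, Matrix.diagonal_conjTranspose,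
    Matrix.diagonal_mul_diagonal, ← Matrix.diagonal_one]
  exact congrArg _ (funext h)

theorem clockZ_pow (k : ℕ) :
    clockZ d ^ k = Matrix.diagonal fun i : Fin d => omega d ^ (k * (i : ℕ)) := by
  rw [clockZ, Matrix.diagonal_pow]
  congr 1
  ext i
  simp [← pow_mul, mul_comm]

variable [NeZero d]

theorem isPrimitiveRoot_omega : IsPrimitiveRoot (omega d) d :=
  Complex.isPrimitiveRoot_exp d (NeZero.ne d)

theorem omega_mul_conj : omega d * conj (omega d) = 1 := by
  rw [Complex.mul_conj, Complex.normSq_eq_norm_sq,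
    Complex.norm_eq_one_of_pow_eq_one isPrimitiveRoot_omega.pow_eq_one (NeZero.ne d)]
  simp

theorem omega_pow_mul_conj (m : ℕ) : omega d ^ m * conj (omega d ^ m) = 1 := by
  rw [map_pow, ← mul_pow, omega_mul_conj, one_pow]

theorem omega_pow_injective {i j : Fin d} (h : omega d ^ (i : ℕ) = omega d ^ (j : ℕ)) : i = j :=
  Fin.ext (isPrimitiveRoot_omega.pow_inj i.2 j.2 h)

/-- Orthogonality of the characters of `ℤ/d`. -/
theorem sum_conj_omega_mul_omega (i j : Fin d) :
    ∑ k : Fin d, conj (omega d ^ ((k : ℕ) * (j : ℕ))) * omega d ^ ((k : ℕ) * (i : ℕ)) =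
      if i = j then (d : ℂ) else 0 := by
  split_ifs with h
  · subst h
    simp [mul_comm (conj _), omega_pow_mul_conj, -map_pow]
  · set ζ : ℂ := conj (omega d ^ (j : ℕ)) * omega d ^ (i : ℕ) with hζ
    have h1 : ζ ≠ 1 := fun h1 => h <| omega_pow_injective <| by
      rw [← one_mul (omega d ^ (i : ℕ)), ← omega_pow_mul_conj (d := d) (j : ℕ), mul_assoc,
        ← hζ, h1, mul_one]
    have hd : ζ ^ d = 1 := by
      rw [hζ, mul_pow, ← map_pow, pow_right_comm, pow_right_comm _ (i : ℕ),
        isPrimitiveRoot_omega.pow_eq_one]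
      simp
    have hk : ∀ k : ℕ, conj (omega d ^ (k * (j : ℕ))) * omega d ^ (k * (i : ℕ)) = ζ ^ k := by
      intro k
      rw [hζ, mul_pow, ← map_pow, ← pow_mul, ← pow_mul, mul_comm k, mul_comm k]
    simp_rw [hk]
    rw [Fin.sum_univ_eq_sum_range (fun k => ζ ^ k) d]
    have := geom_sum_mul ζ d
    rw [hd, sub_self] at this
    exact (mul_eq_zero.1 this).resolve_right (sub_ne_zero.2 h1)

theorem shiftX_apply (i j : Fin d) : shiftX d i j = if i = j + 1 then 1 else 0 := rfl

theorem shiftX_mul_apply (A : Matrix (Fin d) (Fin d) ℂ) (i j : Fin d) :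
    (shiftX d * A) (i + 1) j = A i j := by
  simp [Matrix.mul_apply, shiftX_apply]

theorem shiftX_mem_unitary : shiftX d ∈ Matrix.unitaryGroup (Fin d) ℂ := by
  rw [Matrix.mem_unitaryGroup_iff']
  ext i j
  simp [Matrix.mul_apply, Matrix.star_apply, shiftX_apply, Matrix.one_apply, eq_comm]

theorem shiftX_conjTranspose_transpose : (shiftX d).conjTranspose.transpose = shiftX d := by
  ext i j
  simp [shiftX_apply, apply_ite]

theorem clockZ_mem_unitary : clockZ d ∈ Matrix.unitaryGroup (Fin d) ℂ :=
  diagonal_mem_unitary fun i => omega_pow_mul_conj i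

theorem clockZ_inv : (clockZ d)⁻¹ = star (clockZ d) :=
  Matrix.inv_eq_right_inv (Matrix.mem_unitaryGroup_iff.1 clockZ_mem_unitary)

theorem aliceObs_mem_unitary (k : Fin d) : aliceObs d k ∈ Matrix.unitaryGroup (Fin d) ℂ := by
  rw [aliceObs, clockZ_inv]
  exact mul_mem shiftX_mem_unitary (pow_mem (Unitary.star_mem clockZ_mem_unitary) _)

/-- The entrywise complex conjugate of `A_k = X Z⁻ᵏ` is `X Zᵏ`. -/
theorem aliceObs_conjTranspose_transpose (k : Fin d) :
    (aliceObs d k).conjTranspose.transpose = shiftX d * clockZ d ^ (k : ℕ) := by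
  rw [aliceObs, clockZ_inv, Matrix.conjTranspose_mul, Matrix.transpose_mul,
    shiftX_conjTranspose_transpose, ← Matrix.star_eq_conjTranspose, star_pow, star_star,
    Matrix.transpose_pow, clockZ, Matrix.diagonal_transpose]

/-- Discrete Fourier inversion: the reference observable is the shift times a diagonal matrix of
phases. -/
theorem refObs_one (φ : Fin d → Fin d → ℝ) (y : Fin d) :
    refObs φ 1 y = shiftX d * Matrix.diagonal fun j =>
      Complex.exp (Complex.I * (φ (j + Fin.ofNat d 1) y : ℂ)) := by
  have hd : (d : ℂ) ≠ 0 := Nat.cast_ne_zero.2 (NeZero.ne d)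
  have h : ∀ k : Fin d, conj (gamma φ 1 y k) = (1 / (d : ℂ)) * ∑ l : Fin d,
      Complex.exp (Complex.I * (φ (l + Fin.ofNat d 1) y : ℂ)) *
        conj (omega d ^ ((k : ℕ) * (l : ℕ))) := by
    intro k
    simp [gamma, ← Complex.exp_conj]
  simp only [refObs, pow_one, ← Matrix.mul_smul, ← Matrix.mul_sum, clockZ_pow]
  congr 1
  ext i j
  rw [Matrix.sum_apply]
  by_cases hij : i = j
  · subst hij
    simp only [Matrix.smul_apply, Matrix.diagonal_apply_eq, smul_eq_mul, h, Finset.mul_sum,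
      Finset.sum_mul]
    rw [Finset.sum_comm]
    have h2 : ∀ l : Fin d, ∑ k : Fin d, 1 / (d : ℂ) *
        (Complex.exp (Complex.I * (φ (l + Fin.ofNat d 1) y : ℂ)) *
        conj (omega d ^ ((k : ℕ) * (l : ℕ)))) * omega d ^ ((k : ℕ) * (i : ℕ)) =
        if i = l then Complex.exp (Complex.I * (φ (l + Fin.ofNat d 1) y : ℂ)) else 0 := by
      intro l
      have h3 := congrArg (fun z => 1 / (d : ℂ) *
        Complex.exp (Complex.I * (φ (l + Fin.ofNat d 1) y : ℂ)) * z) (sum_conj_omega_mul_omega i l)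
      simp only [Finset.mul_sum] at h3
      simp only [← mul_assoc] at h3 ⊢
      rw [h3]
      split_ifs
      · field_simp
      · simp
    simp only [h2]
    simp
  · simp [Matrix.diagonal_apply_ne _ hij]

theorem refObs_one_mem_unitary (φ : Fin d → Fin d → ℝ) (y : Fin d) :
    refObs φ 1 y ∈ Matrix.unitaryGroup (Fin d) ℂ := by
  rw [refObs_one]
  refine mul_mem shiftX_mem_unitary (diagonal_mem_unitary fun j => ?_)
  rw [← Complex.exp_conj, ← Complex.exp_add]
  simp

/-- The matrix unit `|j⟩⟨j|` is the average of `ω^{-jk} Zᵏ` over `k`. -/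
theorem single_eq_sum_clockZ (j : Fin d) :
    Matrix.single j j (1 : ℂ) =
      ∑ k : Fin d, ((1 / (d : ℂ)) * conj (omega d ^ ((k : ℕ) * (j : ℕ)))) • clockZ d ^ (k : ℕ) := by
  have hd : (d : ℂ) ≠ 0 := Nat.cast_ne_zero.2 (NeZero.ne d)
  ext a b
  rw [Matrix.sum_apply]
  by_cases hab : a = b
  · subst hab
    simp only [clockZ_pow, Matrix.smul_apply, Matrix.diagonal_apply_eq, smul_eq_mul, mul_assoc]
    rw [← Finset.mul_sum, sum_conj_omega_mul_omega, Matrix.single_apply]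
    split_ifs <;> simp_all
  · simp only [clockZ_pow, Matrix.smul_apply, Matrix.diagonal_apply_ne _ hab, smul_zero,
      Finset.sum_const_zero]
    rw [Matrix.single_apply, if_neg (by rintro ⟨rfl, rfl⟩; exact hab rfl)]

theorem shiftX_mul_single (i j : Fin d) :
    shiftX d * Matrix.single i j (1 : ℂ) = Matrix.single (i + 1) j 1 := by
  ext a b
  obtain ⟨a, rfl⟩ : ∃ a', a = a' + 1 := ⟨a - 1, by simp⟩
  rw [shiftX_mul_apply]
  simp [Matrix.single_apply]

end Matrices

/-! ### Measurements -/

section POVM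

variable {H : Type u} [NormedAddCommGroup H] [InnerProductSpace ℂ H]

variable {d : ℕ} {N : Fin d → H →L[ℂ] H}

theorem IsPOVM.sum_apply (hN : IsPOVM N) (v : H) : ∑ b, N b v = v := by
  rw [← _root_.sum_apply, hN.2, one_apply_eq_self]

theorem genObs_apply (n : ℕ) (v : H) :
    genObs N n v = ∑ b : Fin d, omega d ^ ((b : ℕ) * n) • N b v := by
  simp [genObs]

theorem mul_genObs_pow (h : ∀ b : Fin d, N b * genObs N 1 = omega d ^ (b : ℕ) • N b)
    (b : Fin d) (n : ℕ) : N b * genObs N 1 ^ n = omega d ^ ((b : ℕ) * n) • N b := by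
  induction n with
  | zero => simp
  | succ n ih =>
    rw [pow_succ', ← mul_assoc, h, smul_mul_assoc, ih, smul_smul, ← pow_add]
    ring_nf

theorem IsPOVM.genObs_eq_pow (hN : IsPOVM N)
    (h : ∀ b : Fin d, N b * genObs N 1 = omega d ^ (b : ℕ) • N b) (n : ℕ) :
    genObs N n = genObs N 1 ^ n := by
  rw [genObs, ← one_mul (genObs N 1 ^ n), ← hN.2, Finset.sum_mul]
  exact Finset.sum_congr rfl fun b _ => (mul_genObs_pow h b n).symm

variable [NeZero d]

/-- The defect of contractivity of a generalized observable `B`: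
`1 - B†B = ∑_b (ω^{bn} - B)† N_b (ω^{bn} - B)`. -/
theorem IsPOVM.sum_inner_sub (hN : IsPOVM N) (n : ℕ) (v : H) :
    ∑ b : Fin d, inner ℂ (omega d ^ ((b : ℕ) * n) • v - genObs N n v)
      (N b (omega d ^ ((b : ℕ) * n) • v - genObs N n v)) =
      inner ℂ v v - inner ℂ (genObs N n v) (genObs N n v) := by
  set w := genObs N n v with hw
  have hs : ∀ b x y, inner ℂ (N b x) y = inner ℂ x (N b y) := fun b x y =>
    (hN.1 b).inner_left_eq_inner_right x y
  have hterm : ∀ b : Fin d, inner ℂ (omega d ^ ((b : ℕ) * n) • v - w)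
      (N b (omega d ^ ((b : ℕ) * n) • v - w)) =
      inner ℂ v (N b v) - inner ℂ (omega d ^ ((b : ℕ) * n) • N b v) w
        - inner ℂ w (omega d ^ ((b : ℕ) * n) • N b v) + inner ℂ w (N b w) := by
    intro b
    simp only [map_sub, map_smul, inner_sub_left, inner_sub_right, inner_smul_left,
      inner_smul_right, hs]
    linear_combination (inner ℂ v (N b v)) * omega_pow_mul_conj (d := d) ((b : ℕ) * n)
  simp_rw [hterm]
  rw [Finset.sum_add_distrib, Finset.sum_sub_distrib, Finset.sum_sub_distrib, ← inner_sum,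
    ← inner_sum, ← inner_sum, ← sum_inner, hN.sum_apply, hN.sum_apply, ← genObs_apply, ← hw]
  ring

theorem IsPOVM.sum_re_inner_sub (hN : IsPOVM N) (n : ℕ) (v : H) :
    ∑ b : Fin d, (inner ℂ (omega d ^ ((b : ℕ) * n) • v - genObs N n v)
      (N b (omega d ^ ((b : ℕ) * n) • v - genObs N n v))).re =
      ‖v‖ ^ 2 - ‖genObs N n v‖ ^ 2 := by
  rw [← Complex.re_sum, hN.sum_inner_sub, Complex.sub_re]
  exact congrArg₂ _ (inner_self_eq_norm_sq (𝕜 := ℂ) v) (inner_self_eq_norm_sq (𝕜 := ℂ) _)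

theorem IsPOVM.norm_genObs_sq_le (hN : IsPOVM N) (n : ℕ) (v : H) :
    ‖genObs N n v‖ ^ 2 ≤ ‖v‖ ^ 2 := by
  rw [← sub_nonneg, ← hN.sum_re_inner_sub]
  exact Finset.sum_nonneg fun b _ => (hN.1 b).re_inner_nonneg_right _

theorem IsPOVM.genObs_one_pow_eq_one (hN : IsPOVM N)
    (h : ∀ b : Fin d, N b * genObs N 1 = omega d ^ (b : ℕ) • N b) :
    genObs N 1 ^ d = 1 := by
  rw [← hN.genObs_eq_pow h, genObs]
  simp_rw [mul_comm _ d, pow_mul, isPrimitiveRoot_omega.pow_eq_one, one_pow, one_smul]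
  exact hN.2

variable [CompleteSpace H]

theorem exists_sq_eq_of_isPositive {T : H →L[ℂ] H} (hT : T.IsPositive) :
    ∃ R : H →L[ℂ] H, IsSelfAdjoint R ∧ R * R = T := by
  have h := (ContinuousLinearMap.nonneg_iff_isPositive T).2 hT
  exact ⟨CFC.sqrt T, IsSelfAdjoint.of_nonneg (CFC.sqrt_nonneg T), CFC.sqrt_mul_sqrt_self T h⟩

theorem apply_eq_zero_of_re_inner_eq_zero {T : H →L[ℂ] H} (hT : T.IsPositive) {v : H}
    (h : (inner ℂ v (T v)).re = 0) : T v = 0 := by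
  obtain ⟨R, hR, rfl⟩ := exists_sq_eq_of_isPositive hT
  have h1 : inner ℂ v ((R * R) v) = inner ℂ (R v) (R v) := (hR.isSymmetric v (R v)).symm
  rw [h1] at h
  have h2 : R v = 0 := by
    rw [← norm_eq_zero, ← sq_eq_zero_iff, ← inner_self_eq_norm_sq (𝕜 := ℂ)]
    exact h
  simp [h2]

/-- A vector on which a generalized observable is isometric lies in the kernels of the operators
`N_b (ω^{bn} - B)`. -/
theorem IsPOVM.apply_sub_eq_zero (hN : IsPOVM N) (n : ℕ) {v : H}
    (h : ‖genObs N n v‖ ^ 2 = ‖v‖ ^ 2) (b : Fin d) :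
    N b (omega d ^ ((b : ℕ) * n) • v - genObs N n v) = 0 := by
  have h0 := hN.sum_re_inner_sub n v
  rw [h, sub_self] at h0
  refine apply_eq_zero_of_re_inner_eq_zero (hN.1 b) ?_
  exact (Finset.sum_eq_zero_iff_of_nonneg fun b _ => (hN.1 b).re_inner_nonneg_right _).1 h0 b
    (Finset.mem_univ b)

theorem IsPOVM.genObs_one_mem_unitary (hN : IsPOVM N)
    (h : ∀ b : Fin d, N b * genObs N 1 = omega d ^ (b : ℕ) • N b) :
    genObs N 1 ∈ unitary (H →L[ℂ] H) := by
  have h1 : star (genObs N 1) * genObs N 1 = 1 := by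
    rw [ContinuousLinearMap.star_eq_adjoint]
    refine (ContinuousLinearMap.norm_map_iff_adjoint_comp_self _).1 fun v => ?_
    have h0 : ∀ b, N b (omega d ^ ((b : ℕ) * 1) • v - genObs N 1 v) = 0 := fun b => by
      rw [map_sub, map_smul, mul_one, sub_eq_zero]
      exact (congrArg (· v) (h b)).symm
    have := hN.sum_re_inner_sub 1 v
    simp only [h0, inner_zero_right, Complex.zero_re, Finset.sum_const_zero] at this
    exact ((sq_eq_sq₀ (norm_nonneg _) (norm_nonneg _)).1 (sub_eq_zero.1 this.symm)).symm
  refine Unitary.mem_iff.2 ⟨h1, ?_⟩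
  -- the left inverse `B†` of `B` agrees with its right inverse `B^{d-1}`
  have h2 : genObs N 1 * genObs N 1 ^ (d - 1) = 1 := by
    rw [← pow_succ', Nat.sub_add_cancel (NeZero.one_le), hN.genObs_one_pow_eq_one h]
  rwa [← left_inv_eq_right_inv h1 h2] at h2

theorem IsPOVM.isStarProjection (hN : IsPOVM N)
    (h : ∀ b : Fin d, N b * genObs N 1 = omega d ^ (b : ℕ) • N b) (b : Fin d) :
    IsStarProjection (N b) := by
  have hsa : ∀ c, star (N c) = N c := fun c => (hN.1 c).isSelfAdjoint.star_eq
  set B := genObs N 1 with hB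
  have hu := Unitary.mem_iff.1 (hN.genObs_one_mem_unitary h)
  have h2 : ∀ c, B * N c = omega d ^ (c : ℕ) • N c := fun c => by
    have := congrArg (fun T => omega d ^ (c : ℕ) • (B * star T)) (h c)
    simp only [star_mul, star_smul, hsa, ← mul_assoc, mul_smul_comm, smul_smul] at this
    rw [hu.2, one_mul, ← starRingEnd_apply, omega_pow_mul_conj, one_smul] at this
    exact this.symm
  have horth : ∀ c, c ≠ b → N b * N c = 0 := fun c hc => by
    have h3 : omega d ^ (c : ℕ) • (N b * N c) = omega d ^ (b : ℕ) • (N b * N c) := by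
      rw [← mul_smul_comm, ← h2, ← smul_mul_assoc, ← h, mul_assoc]
    rw [← sub_eq_zero, ← sub_smul, smul_eq_zero, sub_eq_zero] at h3
    exact h3.resolve_left fun h4 => hc (omega_pow_injective h4)
  refine ⟨?_, (hN.1 b).isSelfAdjoint⟩
  have h5 := congrArg (N b * ·) hN.2
  simp only [Finset.mul_sum, mul_one] at h5
  rwa [Finset.sum_eq_single b (fun c _ hc => horth c hc) (by simp)] at h5

end POVM

/-! ### The sum-of-squares bound -/

section Bound

variable {d : ℕ} {H : Type u} [NormedAddCommGroup H] [InnerProductSpace ℂ H]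

theorem coord_map_one {H' : Type*} [NormedAddCommGroup H'] [InnerProductSpace ℂ H']
    (T : H →ₗ[ℂ] H') (i : Fin d) (ψ : Qudit d ⊗[ℂ] H) :
    coord i (TensorProduct.map LinearMap.id T ψ) = T (coord i ψ) := by
  conv_lhs => rw [← sum_ket_tmul_coord ψ]
  simp [ket_apply]

theorem inner_map_eq (A : Matrix (Fin d) (Fin d) ℂ) (T : H →ₗ[ℂ] H) (ψ χ : Qudit d ⊗[ℂ] H) :
    inner ℂ ψ (TensorProduct.map (Matrix.toEuclideanLin A) T χ) =
      inner ℂ (TensorProduct.map (Matrix.toEuclideanLin A.conjTranspose) LinearMap.id ψ)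
        (TensorProduct.map LinearMap.id T χ) := by
  simp only [inner_eq_sum_coord, coord_map, coord_map_one, inner_sum, sum_inner, inner_smul_left,
    inner_smul_right, Matrix.conjTranspose_apply, LinearMap.id_apply]
  rw [Finset.sum_comm]
  simp

theorem norm_map_unitary {A : Matrix (Fin d) (Fin d) ℂ} (hA : A ∈ Matrix.unitaryGroup (Fin d) ℂ)
    (ψ : Qudit d ⊗[ℂ] H) :
    ‖TensorProduct.map (Matrix.toEuclideanLin A.conjTranspose) LinearMap.id ψ‖ ^ 2 = ‖ψ‖ ^ 2 := by
  have h : inner ℂ ψ (TensorProduct.map (Matrix.toEuclideanLin A) LinearMap.id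
      (TensorProduct.map (Matrix.toEuclideanLin A.conjTranspose) LinearMap.id ψ)) =
      inner ℂ ψ ψ := by
    congr 1
    have h1 := Matrix.mem_unitaryGroup_iff.1 hA
    rw [← LinearMap.comp_apply, ← TensorProduct.map_comp, LinearMap.id_comp,
      ← Matrix.toLpLin_mul_same, ← Matrix.star_eq_conjTranspose, h1, Matrix.toLpLin_one,
      TensorProduct.map_id, LinearMap.id_apply]
  rw [inner_map_eq, TensorProduct.map_id, LinearMap.id_apply] at h
  rw [← inner_self_eq_norm_sq (𝕜 := ℂ), h]
  exact inner_self_eq_norm_sq (𝕜 := ℂ) ψ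

/-- An isometric matrix of coefficients preserves the total squared length of a tuple of
vectors. -/
theorem sum_norm_sq_sum_smul {E ι κ : Type*} [NormedAddCommGroup E] [InnerProductSpace ℂ E]
    [Fintype ι] [Fintype κ] [DecidableEq ι] {g : ι → κ → ℂ}
    (hg : ∀ y y', ∑ k, conj (g y' k) * g y k = if y = y' then 1 else 0) (w : ι → E) :
    ∑ k, ‖∑ y, g y k • w y‖ ^ 2 = ∑ y, ‖w y‖ ^ 2 := by
  have h : ∑ k, inner ℂ (∑ y, g y k • w y) (∑ y, g y k • w y) = ∑ y, inner ℂ (w y) (w y) := by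
    simp only [sum_inner, inner_sum, inner_smul_left, inner_smul_right]
    rw [Finset.sum_comm]
    refine Finset.sum_congr rfl fun y _ => ?_
    simp only [Finset.mul_sum]
    rw [Finset.sum_comm]
    have h1 : ∀ y', ∑ k, g y k * (conj (g y' k) * inner ℂ (w y') (w y)) =
        if y = y' then inner ℂ (w y') (w y) else 0 := fun y' => by
      rw [← one_mul (inner ℂ (w y') (w y)), ← ite_zero_mul, ← hg,
        Finset.sum_mul]
      exact Finset.sum_congr rfl fun k _ => by ring
    simp [h1]
  simp only [inner_self_eq_norm_sq_to_K] at h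
  exact_mod_cast h

theorem sum_Icc_const_eq (hd : 1 ≤ d) (c : ℝ) :
    ∑ _n ∈ Finset.Icc 1 (d - 1), (d : ℝ) * c = d * (d - 1) * c := by
  simp [Nat.cast_sub hd]
  ring

variable [NeZero d] {φ : Fin d → Fin d → ℝ} {N : Fin d → Fin d → H →L[ℂ] H}

theorem map_tildeObs_apply (n : ℕ) (k : Fin d) (ψ : Qudit d ⊗[ℂ] H) :
    TensorProduct.map LinearMap.id (tildeObs φ N n k : H →ₗ[ℂ] H) ψ =
      ∑ y, gamma φ n y k • TensorProduct.map LinearMap.id (genObs (N y) n : H →ₗ[ℂ] H) ψ := by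
  refine ext_coord fun i => ?_
  simp [coord_map_one, tildeObs]

/-- The sum-of-squares decomposition of the steering operator on the vector state `ψ`, for the
exponent `n`. -/
theorem two_mul_sum_re_inner_eq {n : ℕ}
    (hγ : ∀ y y' : Fin d, ∑ k, conj (gamma φ n y' k) * gamma φ n y k = if y = y' then 1 else 0)
    (ψ : Qudit d ⊗[ℂ] H) :
    2 * ∑ k : Fin d, (inner ℂ ψ (TensorProduct.map (Matrix.toEuclideanLin (aliceObs d k ^ n))
      (tildeObs φ N n k : H →ₗ[ℂ] H) ψ)).re =
      d * ‖ψ‖ ^ 2 + ∑ y, ‖TensorProduct.map LinearMap.id (genObs (N y) n : H →ₗ[ℂ] H) ψ‖ ^ 2 -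
      ∑ k : Fin d, ‖TensorProduct.map
        (Matrix.toEuclideanLin (aliceObs d k ^ n).conjTranspose) LinearMap.id ψ -
        TensorProduct.map LinearMap.id (tildeObs φ N n k : H →ₗ[ℂ] H) ψ‖ ^ 2 := by
  rw [← sum_norm_sq_sum_smul hγ]
  simp_rw [← map_tildeObs_apply, inner_map_eq, @norm_sub_sq ℂ,
    norm_map_unitary (pow_mem (aliceObs_mem_unitary _) n)]
  rw [Finset.sum_add_distrib, Finset.sum_sub_distrib, ← Finset.mul_sum]
  simp

theorem norm_map_genObs_sq_le [CompleteSpace H] (hN : ∀ y, IsPOVM (N y)) (n : ℕ) (y : Fin d)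
    (ψ : Qudit d ⊗[ℂ] H) :
    ‖TensorProduct.map LinearMap.id (genObs (N y) n : H →ₗ[ℂ] H) ψ‖ ^ 2 ≤ ‖ψ‖ ^ 2 := by
  simp only [norm_sq_eq_sum_coord, coord_map_one]
  exact Finset.sum_le_sum fun i _ => (hN y).norm_genObs_sq_le n _

theorem sum_norm_map_genObs_sq_le [CompleteSpace H] (hN : ∀ y, IsPOVM (N y)) (n : ℕ)
    (ψ : Qudit d ⊗[ℂ] H) :
    ∑ y, ‖TensorProduct.map LinearMap.id (genObs (N y) n : H →ₗ[ℂ] H) ψ‖ ^ 2 ≤ d * ‖ψ‖ ^ 2 := by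
  refine (Finset.sum_le_sum fun y _ => norm_map_genObs_sq_le hN n y ψ).trans ?_
  simp

theorem sum_re_inner_le [CompleteSpace H] (hN : ∀ y, IsPOVM (N y)) {n : ℕ}
    (hγ : ∀ y y' : Fin d, ∑ k, conj (gamma φ n y' k) * gamma φ n y k = if y = y' then 1 else 0)
    (ψ : Qudit d ⊗[ℂ] H) :
    ∑ k : Fin d, (inner ℂ ψ (TensorProduct.map (Matrix.toEuclideanLin (aliceObs d k ^ n))
      (tildeObs φ N n k : H →ₗ[ℂ] H) ψ)).re ≤ d * ‖ψ‖ ^ 2 := by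
  have h1 := two_mul_sum_re_inner_eq (N := N) hγ ψ
  have h2 := sum_norm_map_genObs_sq_le hN n ψ
  have h3 : 0 ≤ ∑ k : Fin d, ‖TensorProduct.map
        (Matrix.toEuclideanLin (aliceObs d k ^ n).conjTranspose) LinearMap.id ψ -
        TensorProduct.map LinearMap.id (tildeObs φ N n k : H →ₗ[ℂ] H) ψ‖ ^ 2 :=
    Finset.sum_nonneg fun _ _ => by positivity
  linarith

/-- Equality in the bound for one exponent: all the squares vanish. -/
theorem eq_of_le_sum_re_inner [CompleteSpace H] (hN : ∀ y, IsPOVM (N y)) {n : ℕ}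
    (hγ : ∀ y y' : Fin d, ∑ k, conj (gamma φ n y' k) * gamma φ n y k = if y = y' then 1 else 0)
    {ψ : Qudit d ⊗[ℂ] H}
    (h : d * ‖ψ‖ ^ 2 ≤ ∑ k : Fin d, (inner ℂ ψ (TensorProduct.map
      (Matrix.toEuclideanLin (aliceObs d k ^ n)) (tildeObs φ N n k : H →ₗ[ℂ] H) ψ)).re) :
    (∀ k, TensorProduct.map LinearMap.id (tildeObs φ N n k : H →ₗ[ℂ] H) ψ =
      TensorProduct.map (Matrix.toEuclideanLin (aliceObs d k ^ n).conjTranspose)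
        LinearMap.id ψ) ∧
    ∀ y i, ‖genObs (N y) n (coord i ψ)‖ ^ 2 = ‖coord i ψ‖ ^ 2 := by
  have h1 := two_mul_sum_re_inner_eq (N := N) hγ ψ
  have h2 := sum_norm_map_genObs_sq_le hN n ψ
  have h3 : 0 ≤ ∑ k : Fin d, ‖TensorProduct.map
        (Matrix.toEuclideanLin (aliceObs d k ^ n).conjTranspose) LinearMap.id ψ -
        TensorProduct.map LinearMap.id (tildeObs φ N n k : H →ₗ[ℂ] H) ψ‖ ^ 2 :=
    Finset.sum_nonneg fun _ _ => by positivity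
  constructor
  · have h4 := (Finset.sum_eq_zero_iff_of_nonneg fun _ _ => by positivity).1
      (le_antisymm (by linarith) h3)
    intro k
    have h5 := h4 k (Finset.mem_univ k)
    rw [sq_eq_zero_iff, norm_eq_zero, sub_eq_zero] at h5
    exact h5.symm
  · have h4 : ∑ y, ‖TensorProduct.map LinearMap.id (genObs (N y) n : H →ₗ[ℂ] H) ψ‖ ^ 2 =
        ∑ _y : Fin d, ‖ψ‖ ^ 2 := by
      rw [Finset.sum_const, Finset.card_univ, Fintype.card_fin, nsmul_eq_mul]
      linarith
    intro y i
    have h5 := (Finset.sum_eq_sum_iff_of_le fun y _ => norm_map_genObs_sq_le hN n y ψ).1 h4 y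
      (Finset.mem_univ y)
    simp only [norm_sq_eq_sum_coord, coord_map_one] at h5
    exact (Finset.sum_eq_sum_iff_of_le fun i _ => (hN y).norm_genObs_sq_le n (coord i ψ)).1 h5 i
      (Finset.mem_univ i)

theorem re_inner_steeringOp (ψ : Qudit d ⊗[ℂ] H) :
    (inner ℂ ψ (steeringOp φ N ψ)).re = ∑ n ∈ Finset.Icc 1 (d - 1), ∑ k : Fin d,
      (inner ℂ ψ (TensorProduct.map (Matrix.toEuclideanLin (aliceObs d k ^ n))
        (tildeObs φ N n k : H →ₗ[ℂ] H) ψ)).re := by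
  simp [steeringOp, inner_sum, LinearMap.sum_apply]

/-- The steering operator as a bounded operator. -/
theorem exists_continuous_steeringOp (φ : Fin d → Fin d → ℝ) (N : Fin d → Fin d → H →L[ℂ] H) :
    ∃ S : (Qudit d ⊗[ℂ] H) →L[ℂ] (Qudit d ⊗[ℂ] H), ∀ ψ, S ψ = steeringOp φ N ψ := by
  refine ⟨∑ n ∈ Finset.Icc 1 (d - 1), ∑ k : Fin d, TensorProduct.mapL
    (Matrix.toEuclideanLin (aliceObs d k ^ n)).toContinuousLinearMap (tildeObs φ N n k),
    fun ψ => ?_⟩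
  simp [steeringOp, _root_.sum_apply, LinearMap.sum_apply]

/-- A density operator that attains the value `d (d - 1)`: the relations forced by the sum of
squares with `n = 1` hold on its whole range. Writing `ρ = R²`, cyclicity of the trace turns the
value of the functional into the sum over a Hilbert basis `b` of the values at the vectors
`R (b i)`, whose squared norms sum to one; so each of these vectors saturates the bound. -/
theorem relations_of_hasTrace [CompleteSpace H] (hd : 2 ≤ d)
    (hγ : ∀ n ∈ Finset.Icc 1 (d - 1), ∀ y y' : Fin d,
      ∑ k, conj (gamma φ n y' k) * gamma φ n y k = if y = y' then 1 else 0)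
    {ρ : (Qudit d ⊗[ℂ] H) →L[ℂ] (Qudit d ⊗[ℂ] H)} (hρ : IsDensityOperator ρ)
    (hN : ∀ y, IsPOVM (N y))
    (hmax : HasTrace ((ρ : (Qudit d ⊗[ℂ] H) →ₗ[ℂ] (Qudit d ⊗[ℂ] H)) ∘ₗ steeringOp φ N)
      ((d : ℂ) * ((d : ℂ) - 1))) (ψ : Qudit d ⊗[ℂ] H) :
    (∀ k i, tildeObs φ N 1 k (coord i (ρ ψ)) =
      ∑ j, (aliceObs d k).conjTranspose i j • coord j (ρ ψ)) ∧
    ∀ y b i, N y b (omega d ^ (b : ℕ) • coord i (ρ ψ) - genObs (N y) 1 (coord i (ρ ψ))) = 0 := by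
  have := completeSpace_qudit_tmul (d := d) (H := H)
  obtain ⟨R, hR, hRR⟩ := exists_sq_eq_of_isPositive hρ.1
  obtain ⟨S, hS⟩ := exists_continuous_steeringOp φ N
  obtain ⟨w, b, -⟩ := exists_hilbertBasis ℂ (Qudit d ⊗[ℂ] H)
  have hnorm : HasSum (fun i => ‖R (b i)‖ ^ 2) 1 := by
    have := Complex.hasSum_re (hρ.2 w b)
    rw [Complex.one_re] at this
    convert this using 2 with i
    rw [← inner_self_eq_norm_sq (𝕜 := ℂ), ← hRR]
    exact congrArg Complex.re (hR.isSymmetric (b i) (R (b i)))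
  have hval : HasSum (fun i => inner ℂ (R (b i)) (S (R (b i)))) ((d : ℂ) * ((d : ℂ) - 1)) := by
    refine hasSum_inner_conj b hR S hnorm.summable ?_
    have := hmax w b
    simp only [LinearMap.comp_apply, ← hS, ← hRR] at this
    exact this
  have hre := (hnorm.mul_left ((d : ℝ) * (d - 1))).sub (Complex.hasSum_re hval)
  have hdre : ((d : ℂ) * ((d : ℂ) - 1)).re = (d : ℝ) * (d - 1) := by simp
  rw [hdre, mul_one, sub_self] at hre
  have hle : ∀ i, (inner ℂ (R (b i)) (S (R (b i)))).re ≤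
      (d : ℝ) * (d - 1) * ‖R (b i)‖ ^ 2 := fun i => by
    rw [hS, re_inner_steeringOp, ← sum_Icc_const_eq (by omega)]
    exact Finset.sum_le_sum fun n hn => sum_re_inner_le hN (hγ n hn) _
  have heq := (hasSum_zero_iff_of_nonneg fun i => sub_nonneg.2 (hle i)).1 hre
  have h1mem : 1 ∈ Finset.Icc 1 (d - 1) := Finset.mem_Icc.2 ⟨le_rfl, by omega⟩
  have hrel : ∀ i, _ := fun i => by
    have h1 := sub_eq_zero.1 (congrFun heq i)
    rw [hS, re_inner_steeringOp, ← sum_Icc_const_eq (by omega)] at h1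
    have h2 := (Finset.sum_eq_sum_iff_of_le fun n hn =>
      sum_re_inner_le hN (hγ n hn) (R (b i))).1 h1.symm 1 h1mem
    exact eq_of_le_sum_re_inner hN (hγ 1 h1mem) h2.ge
  -- both relations are equations between bounded operators, so that the basis suffices
  have hext : ∀ {T : (Qudit d ⊗[ℂ] H) →L[ℂ] H}, (∀ i, T (R (b i)) = 0) → T (ρ ψ) = 0 := by
    intro T hT
    have h0 : T ∘L R = 0 :=
      ContinuousLinearMap.ext_on (Submodule.dense_iff_topologicalClosure_eq_top.2 b.dense_span)
        (by rintro _ ⟨i, rfl⟩; simpa using hT i)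
    rw [← hRR]
    exact congrArg (fun F => F (R ψ)) h0
  constructor
  · intro k i
    have := hext (T := tildeObs φ N 1 k ∘L coord i -
      ∑ j, (aliceObs d k).conjTranspose i j • coord j) fun a => by
        have h1 := congrArg (coord i) ((hrel a).1 k)
        rw [coord_map_one, coord_map, pow_one] at h1
        simp only [_root_.sub_apply, _root_.sum_apply, ContinuousLinearMap.comp_apply,
          _root_.smul_apply, sub_eq_zero]
        exact h1
    simpa only [_root_.sub_apply, _root_.sum_apply, ContinuousLinearMap.comp_apply,
      _root_.smul_apply, sub_eq_zero] using this
  · intro y c i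
    have := hext (T := N y c ∘L (omega d ^ (c : ℕ) • coord i - genObs (N y) 1 ∘L coord i))
      fun a => by
        simpa using (hN y).apply_sub_eq_zero 1 ((hrel a).2 y i) c
    simpa using this

end Bound

/-! ### Transferring Alice's matrices to Bob's space -/

section Transfer

variable {d : ℕ} {H : Type u} [NormedAddCommGroup H] [InnerProductSpace ℂ H]

/-- `Transfers ρ M T` says that `(1 ⊗ T) ρ = (Mᵀ ⊗ 1) ρ`, in coordinates. The transpose makes the
relation multiplicative in `(M, T)`. -/
def Transfers (ρ : (Qudit d ⊗[ℂ] H) →L[ℂ] (Qudit d ⊗[ℂ] H)) (M : Matrix (Fin d) (Fin d) ℂ)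
    (T : H →L[ℂ] H) : Prop :=
  ∀ i ψ, T (coord i (ρ ψ)) = ∑ j, M j i • coord j (ρ ψ)

variable {ρ : (Qudit d ⊗[ℂ] H) →L[ℂ] (Qudit d ⊗[ℂ] H)} {M M' : Matrix (Fin d) (Fin d) ℂ}
  {T T' : H →L[ℂ] H}

theorem Transfers.add (h : Transfers ρ M T) (h' : Transfers ρ M' T') :
    Transfers ρ (M + M') (T + T') := fun i ψ => by
  simp [h i ψ, h' i ψ, add_smul, Finset.sum_add_distrib]

theorem Transfers.mul (h : Transfers ρ M T) (h' : Transfers ρ M' T') :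
    Transfers ρ (M * M') (T * T') := fun i ψ => by
  simp only [mul_apply_eq_comp, h' i ψ, map_sum, map_smul, h _ ψ, Finset.smul_sum,
    smul_smul, Matrix.mul_apply, Finset.sum_smul]
  rw [Finset.sum_comm]
  simp only [mul_comm]

theorem Transfers.algebraMap (c : ℂ) :
    Transfers ρ (algebraMap ℂ (Matrix (Fin d) (Fin d) ℂ) c) (algebraMap ℂ (H →L[ℂ] H) c) :=
  fun i ψ => by
    simp [Matrix.algebraMap_eq_diagonal, Matrix.diagonal_apply, ite_smul,
      ContinuousLinearMap.algebraMap_apply]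

theorem Transfers.zero : Transfers ρ 0 0 := fun i ψ => by simp

theorem Transfers.sum_smul {ι : Type*} (s : Finset ι) (c : ι → ℂ)
    {M : ι → Matrix (Fin d) (Fin d) ℂ} {T : ι → H →L[ℂ] H} (h : ∀ k, Transfers ρ (M k) (T k)) :
    Transfers ρ (∑ k ∈ s, c k • M k) (∑ k ∈ s, c k • T k) := fun i ψ => by
  simp only [_root_.sum_apply, _root_.smul_apply, h _ i ψ, Matrix.sum_apply, Matrix.smul_apply,
    Finset.sum_smul, Finset.smul_sum, smul_eq_mul, smul_smul]
  rw [Finset.sum_comm]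

theorem bobState_apply (v : H) : bobState ρ v = ∑ i, coord i (ρ (ket i ⊗ₜ[ℂ] v)) := by
  simp [bobState, coord]

theorem inner_coord_apply_ket_tmul (hρ : ρ.IsPositive) (i j : Fin d) (u v : H) :
    inner ℂ u (coord i (ρ (ket j ⊗ₜ[ℂ] v))) = inner ℂ (coord j (ρ (ket i ⊗ₜ[ℂ] u))) v := by
  rw [← inner_ket_tmul_left, ← hρ.inner_left_eq_inner_right, ← inner_conj_symm,
    inner_ket_tmul_left, inner_conj_symm]

variable [CompleteSpace H]

/-- Full support of Bob's reduced state makes the transferred operator unique. -/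
theorem Transfers.unique (hρ : ρ.IsPositive) (hsupp : ∀ v : H, bobState ρ v = 0 → v = 0)
    (h : Transfers ρ M T) (h' : Transfers ρ M T') : T = T' := by
  rw [← sub_eq_zero, ← star_eq_zero]
  ext w
  refine hsupp _ ?_
  rw [bobState_apply]
  refine Finset.sum_eq_zero fun i _ => ext_inner_left ℂ fun u => ?_
  rw [inner_coord_apply_ket_tmul hρ, ContinuousLinearMap.star_eq_adjoint,
    ContinuousLinearMap.adjoint_inner_right]
  simp [h i _, h' i _]

theorem mul_genObs_of_apply_sub_eq_zero {N : Fin d → Fin d → H →L[ℂ] H} (hρ : ρ.IsPositive)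
    (hsupp : ∀ v : H, bobState ρ v = 0 → v = 0)
    (h : ∀ y b i ψ, N y b (omega d ^ (b : ℕ) • coord i (ρ ψ) -
      genObs (N y) 1 (coord i (ρ ψ))) = 0) (y b : Fin d) :
    N y b * genObs (N y) 1 = omega d ^ (b : ℕ) • N y b := by
  have h1 : Transfers ρ 0 (omega d ^ (b : ℕ) • N y b - N y b * genObs (N y) 1) := fun i ψ => by
    simpa using h y b i ψ
  exact (sub_eq_zero.1 (h1.unique hρ hsupp Transfers.zero)).symm

/-- A unitary matrix that is transferred to an isometry has its adjoint transferred to the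
adjoint. -/
theorem Transfers.star_of_unitary (h : Transfers ρ M T) (hM : M ∈ Matrix.unitaryGroup (Fin d) ℂ)
    (hT : star T * T = 1) : Transfers ρ (star M) (star T) := fun i ψ => by
  have h1 : ∀ l, coord l (ρ ψ) = ∑ j, M j l • star T (coord j (ρ ψ)) := fun l => by
    rw [← one_apply_eq_self (F := H →L[ℂ] H) (coord l (ρ ψ)), ← hT, mul_apply_eq_comp,
      h l ψ, map_sum]
    simp only [map_smul]
  have h2 := Matrix.mem_unitaryGroup_iff.1 hM
  symm
  calc ∑ l, (star M) l i • coord l (ρ ψ)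
      = ∑ l, ∑ j, (M j l * (star M) l i) • star T (coord j (ρ ψ)) := by
        refine Finset.sum_congr rfl fun l _ => ?_
        rw [h1 l, Finset.smul_sum]
        simp only [smul_smul, mul_comm]
    _ = ∑ j, (M * star M) j i • star T (coord j (ρ ψ)) := by
        rw [Finset.sum_comm]
        simp only [← Finset.sum_smul, Matrix.mul_apply]
    _ = star T (coord i (ρ ψ)) := by
        rw [h2]
        simp [Matrix.one_apply]

/-- The pairs `(M, T)` for which `M` is transferred to `T` and `M†` to `T†`. -/
def transferAlgebra (ρ : (Qudit d ⊗[ℂ] H) →L[ℂ] (Qudit d ⊗[ℂ] H)) :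
    StarSubalgebra ℂ (Matrix (Fin d) (Fin d) ℂ × (H →L[ℂ] H)) where
  carrier := {p | Transfers ρ p.1 p.2 ∧ Transfers ρ (star p.1) (star p.2)}
  mul_mem' := fun {p q} hp hq => ⟨hp.1.mul hq.1, by
    simpa only [Prod.fst_mul, Prod.snd_mul, star_mul] using hq.2.mul hp.2⟩
  add_mem' := fun {p q} hp hq => ⟨hp.1.add hq.1, by
    simpa only [Prod.fst_add, Prod.snd_add, star_add] using hp.2.add hq.2⟩
  algebraMap_mem' := fun c => ⟨Transfers.algebraMap c, by
    have := Transfers.algebraMap (ρ := ρ) (conj c)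
    rwa [starRingEnd_apply, algebraMap_star_comm, algebraMap_star_comm] at this⟩
  star_mem' := fun {p} hp => ⟨hp.2, by simpa using hp.1⟩

variable [NeZero d]

/-- The matrices that can be transferred include all matrix units as soon as they include `X` and
`X Z`, since these generate the full matrix algebra. -/
theorem exists_transfer_single (hd : 2 ≤ d)
    (h : ∀ k : Fin d, ∃ T, (shiftX d * clockZ d ^ (k : ℕ), T) ∈ transferAlgebra ρ) (i j : Fin d) :
    ∃ T, (Matrix.single i j (1 : ℂ), T) ∈ transferAlgebra ρ := by
  obtain ⟨TX, hX⟩ := h 0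
  obtain ⟨TXZ, hXZ⟩ := h ⟨1, by omega⟩
  simp only [Fin.val_zero, pow_zero, mul_one, pow_one] at hX hXZ
  -- `Z = X† (X Z)`
  have hZ : (clockZ d, star TX * TXZ) ∈ transferAlgebra ρ := by
    have := mul_mem (star_mem hX) hXZ
    rwa [Prod.star_def, Prod.mk_mul_mk, ← mul_assoc,
      Matrix.mem_unitaryGroup_iff'.1 shiftX_mem_unitary, one_mul] at this
  have hjj : ∃ T, (Matrix.single j j (1 : ℂ), T) ∈ transferAlgebra ρ := by
    refine ⟨∑ k : Fin d, ((1 / (d : ℂ)) * conj (omega d ^ ((k : ℕ) * (j : ℕ)))) •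
      (star TX * TXZ) ^ (k : ℕ), ?_⟩
    rw [single_eq_sum_clockZ, prod_mk_sum]
    exact sum_mem fun k _ => SMulMemClass.smul_mem _ (pow_mem hZ (k : ℕ))
  -- multiplying by `X` moves `|i⟩⟨j|` to `|i+1⟩⟨j|`
  have hshift : ∀ m : ℕ, ∃ T,
      (Matrix.single (j + Fin.ofNat d m) j (1 : ℂ), T) ∈ transferAlgebra ρ := by
    intro m
    induction m with
    | zero => simpa using hjj
    | succ m ih =>
      obtain ⟨T, hT⟩ := ih
      refine ⟨TX * T, ?_⟩
      have := mul_mem hX hT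
      rw [Prod.mk_mul_mk, shiftX_mul_single] at this
      have hm : j + Fin.ofNat d (m + 1) = j + Fin.ofNat d m + 1 := by
        rw [add_assoc]
        congr 1
        ext
        simp [Fin.val_add]
      rwa [hm]
  obtain ⟨T, hT⟩ := hshift (i - j : Fin d)
  refine ⟨T, ?_⟩
  simpa using hT

end Transfer

/-! ### Matrix units -/

/-- A system of `d × d` matrix units in the bounded operators on `H`. -/
structure IsMatrixUnits {d : ℕ} {H : Type u} [NormedAddCommGroup H] [InnerProductSpace ℂ H]
    [CompleteSpace H] (e : Fin d → Fin d → H →L[ℂ] H) : Prop where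
  mul_apply : ∀ i j k l v, e i j (e k l v) = if j = k then e i l v else 0
  sum_apply : ∀ v, ∑ i, e i i v = v
  inner_left : ∀ i j u v, inner ℂ (e i j u) v = inner ℂ u (e j i v)

section Units

variable {d : ℕ} {H : Type u} [NormedAddCommGroup H] [InnerProductSpace ℂ H] [CompleteSpace H]
  {ρ : (Qudit d ⊗[ℂ] H) →L[ℂ] (Qudit d ⊗[ℂ] H)}

theorem isMatrixUnits_of_transfer (hρ : ρ.IsPositive)
    (hsupp : ∀ v : H, bobState ρ v = 0 → v = 0) {e : Fin d → Fin d → H →L[ℂ] H}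
    (he : ∀ i j, (Matrix.single i j (1 : ℂ), e i j) ∈ transferAlgebra ρ) : IsMatrixUnits e where
  mul_apply i j k l v := by
    have h := (mul_mem (he i j) (he k l)).1
    have h2 : e i j * e k l = if j = k then e i l else 0 := by
      refine h.unique hρ hsupp ?_
      simp only [Prod.mk_mul_mk]
      split_ifs with hjk
      · subst hjk
        rw [Matrix.single_mul_single_same, one_mul]
        exact (he i l).1
      · rw [Matrix.single_mul_single_of_ne _ _ _ _ hjk]
        exact Transfers.zero
    have h3 := congrArg (fun T => T v) h2
    simp only [mul_apply_eq_comp] at h3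
    rw [h3]
    split_ifs <;> simp
  sum_apply v := by
    have h := (sum_mem fun i (_ : i ∈ Finset.univ) => he i i).1
    have h1 : ∑ i, e i i = 1 := by
      rw [← prod_mk_sum] at h
      refine h.unique hρ hsupp ?_
      have h2 : ∑ i : Fin d, Matrix.single i i (1 : ℂ) = 1 := by
        simp_rw [← Matrix.diagonal_single]
        ext a b
        by_cases hab : a = b <;> simp [Matrix.sum_apply, Matrix.one_apply, hab, Pi.single_apply]
      simp only [h2]
      exact (one_mem (transferAlgebra ρ)).1
    rw [← _root_.sum_apply, h1, one_apply_eq_self]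
  inner_left i j u v := by
    have h : star (e i j) = e j i := by
      refine (he i j).2.unique hρ hsupp ?_
      rw [Matrix.star_eq_conjTranspose, Matrix.conjTranspose_single, star_one]
      exact (he j i).1
    rw [← h, ContinuousLinearMap.star_eq_adjoint, ContinuousLinearMap.adjoint_inner_right]

theorem apply_coord_of_transfer {e : Fin d → Fin d → H →L[ℂ] H}
    (he : ∀ i j, (Matrix.single i j (1 : ℂ), e i j) ∈ transferAlgebra ρ) (a b i : Fin d)
    (ψ : Qudit d ⊗[ℂ] H) :
    e a b (coord i (ρ ψ)) = if b = i then coord a (ρ ψ) else 0 := by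
  rw [(he a b).1 i ψ]
  simp [Matrix.single_apply, ite_and]

theorem eq_sum_of_transfer (hρ : ρ.IsPositive)
    (hsupp : ∀ v : H, bobState ρ v = 0 → v = 0) {e : Fin d → Fin d → H →L[ℂ] H}
    (he : ∀ i j, (Matrix.single i j (1 : ℂ), e i j) ∈ transferAlgebra ρ)
    {M : Matrix (Fin d) (Fin d) ℂ} {T : H →L[ℂ] H} (h : Transfers ρ M T) :
    T = ∑ i, ∑ j, M i j • e i j := by
  refine h.unique hρ hsupp ?_
  have h1 : M = ∑ i, ∑ j, M i j • Matrix.single i j (1 : ℂ) := by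
    conv_lhs => rw [Matrix.matrix_eq_sum_single M]
    simp [Matrix.smul_single]
  have h2 : ((∑ i, ∑ j, M i j • Matrix.single i j (1 : ℂ) : Matrix (Fin d) (Fin d) ℂ),
      ∑ i, ∑ j, M i j • e i j) ∈ transferAlgebra ρ := by
    simp only [prod_mk_sum]
    exact sum_mem fun i _ => sum_mem fun j _ => SMulMemClass.smul_mem _ (he i j)
  rw [← h1] at h2
  exact h2.1

end Units

/-! ### The splitting of Bob's space -/

section Decomposition

variable {d : ℕ} [NeZero d] {H : Type u} [NormedAddCommGroup H] [InnerProductSpace ℂ H]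
  {e : Fin d → Fin d → H →L[ℂ] H}

/-- The corner `e₀₀ H` cut out by the first diagonal matrix unit, as the closed subspace of fixed
vectors of `e₀₀`. -/
def corner (e : Fin d → Fin d → H →L[ℂ] H) : Submodule ℂ H :=
  LinearMap.ker ((e 0 0 - 1 : H →L[ℂ] H) : H →ₗ[ℂ] H)

theorem mem_corner {v : H} : v ∈ corner e ↔ e 0 0 v = v := by
  simp [corner, sub_eq_zero]

variable {ρ : (Qudit d ⊗[ℂ] H) →L[ℂ] (Qudit d ⊗[ℂ] H)}

/-- Bob's residual state on the corner, `σ = d (⟨0| ⊗ 1) ρ (|0⟩ ⊗ 1)`. The hypothesis makes the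
corner invariant. -/
noncomputable def residualState (ρ : (Qudit d ⊗[ℂ] H) →L[ℂ] (Qudit d ⊗[ℂ] H))
    (h : ∀ ψ, e 0 0 (coord 0 (ρ ψ)) = coord 0 (ρ ψ)) : corner e →L[ℂ] corner e :=
  (d : ℂ) • (coord 0 ∘L ρ ∘L TensorProduct.mkL ℂ (Qudit d) H (ket 0) ∘L
    (corner e).subtypeL).codRestrict (corner e) fun _ => mem_corner.2 (h _)

theorem residualState_apply (h : ∀ ψ, e 0 0 (coord 0 (ρ ψ)) = coord 0 (ρ ψ)) (v : corner e) :
    (residualState ρ h v : H) = (d : ℂ) • coord 0 (ρ (ket 0 ⊗ₜ[ℂ] (v : H))) := by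
  simp [residualState]

theorem isPositive_residualState (hρ : ρ.IsPositive)
    (h : ∀ ψ, e 0 0 (coord 0 (ρ ψ)) = coord 0 (ρ ψ)) : (residualState ρ h).IsPositive := by
  have h1 : ∀ u v : corner e, inner ℂ u (residualState ρ h v) =
      (d : ℂ) * inner ℂ (u : H) (coord 0 (ρ (ket 0 ⊗ₜ[ℂ] (v : H)))) := fun u v => by
    rw [Submodule.coe_inner, residualState_apply, inner_smul_right]
  refine ⟨fun u v => ?_, fun v => ?_⟩
  · change inner ℂ (residualState ρ h u) v = inner ℂ u (residualState ρ h v)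
    rw [← inner_conj_symm, h1, h1, map_mul, inner_conj_symm, inner_coord_apply_ket_tmul hρ,
      Complex.conj_natCast]
  · change 0 ≤ (inner ℂ (residualState ρ h v) v).re
    rw [← inner_conj_symm, Complex.conj_re, h1, ← Complex.ofReal_natCast, Complex.re_ofReal_mul,
      ← inner_ket_tmul_left]
    exact mul_nonneg (Nat.cast_nonneg d) (hρ.re_inner_nonneg_right _)

variable [CompleteSpace H]

theorem completeSpace_corner (e : Fin d → Fin d → H →L[ℂ] H) : CompleteSpace (corner e) :=
  (ContinuousLinearMap.isClosed_ker (e 0 0 - 1)).completeSpace_coe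

theorem IsMatrixUnits.mem_corner (he : IsMatrixUnits e) (j : Fin d) (v : H) :
    e 0 j v ∈ corner e := by
  rw [Steering.mem_corner, he.mul_apply, if_pos rfl]

/-- Matrix units split the space: `v ↦ ∑ᵢ |i⟩ ⊗ e₀ᵢ v` is a unitary from `H` onto
`ℂ^d ⊗ e₀₀ H`. -/
noncomputable def IsMatrixUnits.unitary (he : IsMatrixUnits e) :
    H ≃ₗᵢ[ℂ] (Qudit d ⊗[ℂ] corner e) where
  toFun v := ∑ i, ket i ⊗ₜ[ℂ] (⟨e 0 i v, he.mem_corner i v⟩ : corner e)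
  invFun ψ := ∑ i, e i 0 (coord i ψ : corner e)
  map_add' u v := by
    refine ext_coord fun i => Subtype.ext ?_
    simp [ket_apply]
  map_smul' c v := by
    refine ext_coord fun i => Subtype.ext ?_
    simp [ket_apply]
  left_inv v := by
    simp only [coord_sum_ket_tmul, he.mul_apply, if_true, he.sum_apply]
  right_inv ψ := by
    refine ext_coord fun i => Subtype.ext ?_
    have h : ∀ j, e 0 0 (coord j ψ : corner e) = (coord j ψ : corner e) := fun j =>
      Steering.mem_corner.1 (coord j ψ).2
    rw [coord_sum_ket_tmul]
    simp [he.mul_apply, h]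
  norm_map' v := by
    rw [← sq_eq_sq₀ (norm_nonneg _) (norm_nonneg _), norm_sq_eq_sum_coord]
    have h : ∑ i, inner ℂ (e 0 i v) (e 0 i v) = inner ℂ v v := by
      simp only [he.inner_left, he.mul_apply, if_true]
      rw [← inner_sum, he.sum_apply]
    simp only [inner_self_eq_norm_sq_to_K] at h
    simp only [LinearMap.coe_mk, AddHom.coe_mk, LinearEquiv.coe_mk, coord_sum_ket_tmul,
      Submodule.coe_norm]
    exact_mod_cast h

theorem IsMatrixUnits.coord_unitary (he : IsMatrixUnits e) (i : Fin d) (v : H) :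
    ((coord i (he.unitary v) : corner e) : H) = e 0 i v :=
  congrArg Subtype.val (coord_sum_ket_tmul i fun i => (⟨e 0 i v, he.mem_corner i v⟩ : corner e))

theorem IsMatrixUnits.unitary_symm_apply (he : IsMatrixUnits e) (ψ : Qudit d ⊗[ℂ] corner e) :
    he.unitary.symm ψ = ∑ i, e i 0 (coord i ψ : corner e) := rfl

theorem IsMatrixUnits.unitary_symm_ket_tmul (he : IsMatrixUnits e) (i : Fin d) (v : corner e) :
    he.unitary.symm (ket i ⊗ₜ[ℂ] v) = e i 0 v := by
  rw [he.unitary_symm_apply, Finset.sum_eq_single i] <;> simp +contextual [ket_apply]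

theorem IsMatrixUnits.unitary_conj (he : IsMatrixUnits e) (M : Matrix (Fin d) (Fin d) ℂ) :
    (he.unitary.toLinearEquiv : H →ₗ[ℂ] (Qudit d ⊗[ℂ] corner e)) ∘ₗ
      ((∑ i, ∑ j, M i j • e i j : H →L[ℂ] H) : H →ₗ[ℂ] H) ∘ₗ
      (he.unitary.symm.toLinearEquiv : (Qudit d ⊗[ℂ] corner e) →ₗ[ℂ] H) =
    TensorProduct.map (Matrix.toEuclideanLin M) LinearMap.id := by
  refine LinearMap.ext fun ψ => ext_coord fun i => Subtype.ext ?_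
  have h : ∀ j, e 0 0 (coord j ψ : corner e) = (coord j ψ : corner e) := fun j =>
    Steering.mem_corner.1 (coord j ψ).2
  rw [coord_map]
  refine (he.coord_unitary i _).trans ?_
  change e 0 i ((∑ i, ∑ j, M i j • e i j : H →L[ℂ] H) (he.unitary.symm ψ)) = _
  rw [he.unitary_symm_apply]
  simp only [_root_.sum_apply, _root_.smul_apply, map_sum, map_smul, he.mul_apply,
    apply_ite (e 0 i), map_zero]
  simp [h]

/-- The hypothesis `htr` is the relation `(1 ⊗ e_{ab}) ρ = (|b⟩⟨a| ⊗ 1) ρ`; the conclusion is a case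
of its adjoint. -/
theorem coord_apply_ket_tmul (hρ : ρ.IsPositive) (he : IsMatrixUnits e)
    (htr : ∀ a b i ψ, e a b (coord i (ρ ψ)) = if b = i then coord a (ρ ψ) else 0)
    (i a : Fin d) (v : H) :
    coord 0 (ρ (ket i ⊗ₜ[ℂ] e a 0 v)) =
      if a = i then coord 0 (ρ (ket 0 ⊗ₜ[ℂ] v)) else 0 := by
  refine ext_inner_left ℂ fun u => ?_
  rw [inner_coord_apply_ket_tmul hρ, ← he.inner_left, htr]
  split_ifs
  · rw [← inner_coord_apply_ket_tmul hρ]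
  · simp

/-- The trace of the residual state, computed in the Hilbert basis `|i⟩ ⊗ U†(|a⟩ ⊗ b j)` of
`ℂ^d ⊗ H`, in which only the entries with `i = a` contribute. -/
theorem hasTrace_residualState (hρ : IsDensityOperator ρ) (he : IsMatrixUnits e)
    (htr : ∀ a b i ψ, e a b (coord i (ρ ψ)) = if b = i then coord a (ρ ψ) else 0)
    (h : ∀ ψ, e 0 0 (coord 0 (ρ ψ)) = coord 0 (ρ ψ)) :
    HasTrace (residualState ρ h : corner e →ₗ[ℂ] corner e) 1 := by
  intro ι b
  have := completeSpace_corner e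
  obtain ⟨c, hc⟩ := exists_hilbertBasis_tmul (d := d) b
  let c' : HilbertBasis (Fin d × ι) ℂ H := HilbertBasis.ofRepr (he.unitary.trans c.repr)
  have hc' : ∀ p, c' p = e p.1 0 (b p.2) := fun p => by
    rw [← he.unitary_symm_ket_tmul, ← hc]
    rfl
  obtain ⟨f, hf⟩ := exists_hilbertBasis_tmul (d := d) c'
  let s : ι × (Fin d × Fin d) ≃ Fin d × (Fin d × ι) :=
    { toFun := fun p => (p.2.1, p.2.2, p.1)
      invFun := fun p => (p.2.2, p.1, p.2.1)
      left_inv := fun _ => rfl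
      right_inv := fun _ => rfl }
  refine (s.hasSum_iff.2 (hρ.2 _ f)).prod_fiberwise fun j => ?_
  have hd : (d : ℂ) ≠ 0 := Nat.cast_ne_zero.2 (NeZero.ne d)
  have hterm : ∀ p : Fin d × Fin d, ((fun q => inner ℂ (f q) (ρ (f q))) ∘ s) (j, p) =
      if p.1 = p.2 then (d : ℂ)⁻¹ * inner ℂ (b j) (residualState ρ h (b j)) else 0 := by
    rintro ⟨i, a⟩
    simp only [Function.comp_apply, s, Equiv.coe_fn_mk, hf, hc']
    rw [inner_ket_tmul_left, he.inner_left, htr, Submodule.coe_inner, residualState_apply,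
      inner_smul_right, inv_mul_cancel_left₀ hd, coord_apply_ket_tmul hρ.1 he htr]
    simp only [eq_comm (a := a)]
    split_ifs <;> simp
  have hval : ∑ p, ((fun q => inner ℂ (f q) (ρ (f q))) ∘ s) (j, p) =
      inner ℂ (b j) (residualState ρ h (b j)) := by
    simp only [hterm]
    rw [Fintype.sum_prod_type]
    simp [mul_inv_cancel_left₀ hd]
  exact hval ▸ hasSum_fintype fun p => ((fun q => inner ℂ (f q) (ρ (f q))) ∘ s) (j, p)

/-- In the frame of the unitary the shared state is `|φ_d^+⟩⟨φ_d^+| ⊗ σ`. On `|i⟩ ⊗ |a⟩ ⊗ v` the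
relation `htr` and its adjoint leave the factor `δ_{ia}` and equal components along all
`|j⟩ ⊗ |j⟩`. -/
theorem conj_unitary_state (hρ : ρ.IsPositive) (he : IsMatrixUnits e)
    (htr : ∀ a b i ψ, e a b (coord i (ρ ψ)) = if b = i then coord a (ρ ψ) else 0)
    (h : ∀ ψ, e 0 0 (coord 0 (ρ ψ)) = coord 0 (ρ ψ)) :
    TensorProduct.map LinearMap.id
        (he.unitary.toLinearEquiv : H →ₗ[ℂ] (Qudit d ⊗[ℂ] corner e)) ∘ₗ
      (ρ : (Qudit d ⊗[ℂ] H) →ₗ[ℂ] (Qudit d ⊗[ℂ] H)) ∘ₗ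
      TensorProduct.map LinearMap.id
        (he.unitary.symm.toLinearEquiv : (Qudit d ⊗[ℂ] corner e) →ₗ[ℂ] H) =
    (TensorProduct.assoc ℂ (Qudit d) (Qudit d) (corner e)).conj
      (TensorProduct.map
        (InnerProductSpace.rankOne ℂ (maxEntangled d) (maxEntangled d) :
          (Qudit d ⊗[ℂ] Qudit d) →ₗ[ℂ] (Qudit d ⊗[ℂ] Qudit d))
        (residualState ρ h : corner e →ₗ[ℂ] corner e)) := by
  refine linearMap_ext_ket (H := Qudit d ⊗[ℂ] corner e) fun i χ => ?_
  rw [← sum_ket_tmul_coord χ]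
  simp only [TensorProduct.tmul_sum, map_sum]
  refine Finset.sum_congr rfl fun a _ => ?_
  generalize coord a χ = v
  have hd : ((1 / Real.sqrt d : ℝ) : ℂ) * ((1 / Real.sqrt d : ℝ) : ℂ) * (d : ℂ) = 1 := by
    have h0 : (0 : ℝ) < d := Nat.cast_pos.2 (NeZero.pos d)
    have h1 : (1 / Real.sqrt d) * (1 / Real.sqrt d) * (d : ℝ) = 1 := by
      rw [div_mul_div_comm, Real.mul_self_sqrt h0.le]
      field_simp
    exact_mod_cast h1
  refine ext_coord fun j => ext_coord fun l => Subtype.ext ?_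
  simp only [LinearMap.comp_apply, coord_map_one, LinearEquiv.conj_apply]
  refine (he.coord_unitary l _).trans ?_
  simp only [TensorProduct.map_tmul, LinearMap.id_apply, LinearEquiv.coe_coe,
    TensorProduct.assoc_symm_tmul, ContinuousLinearMap.coe_coe, InnerProductSpace.rankOne_apply,
    inner_maxEntangled_ket_tmul_ket, LinearIsometryEquiv.coe_toLinearEquiv,
    he.unitary_symm_ket_tmul]
  rw [htr, ← TensorProduct.smul_tmul', map_smul, assoc_maxEntangled_tmul,
    coord_apply_ket_tmul hρ he htr]
  simp only [map_smul, coord_sum_ket_tmul, coord_ket_tmul]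
  split_ifs
  · simp only [Submodule.coe_smul, residualState_apply, smul_smul]
    rw [hd, one_smul]
  all_goals simp

end Decomposition

/-! ### Consequences of the maximal value -/

section Rigidity

variable {d : ℕ} [NeZero d] {H : Type u} [NormedAddCommGroup H] [InnerProductSpace ℂ H]
  {φ : Fin d → Fin d → ℝ} {N : Fin d → Fin d → H →L[ℂ] H}
  {ρ : (Qudit d ⊗[ℂ] H) →L[ℂ] (Qudit d ⊗[ℂ] H)}

/-- The square matrix `γ^{(n)}` has orthonormal columns as well as orthonormal rows. -/
theorem sum_gamma_mul_conj {n : ℕ}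
    (hγ : ∀ y y' : Fin d, ∑ k, conj (gamma φ n y' k) * gamma φ n y k = if y = y' then 1 else 0)
    (k k' : Fin d) :
    ∑ y, gamma φ n y k * conj (gamma φ n y k') = if k = k' then 1 else 0 := by
  let G : Matrix (Fin d) (Fin d) ℂ := Matrix.of fun y k => gamma φ n y k
  have h : G * G.conjTranspose = 1 := by
    ext y y'
    simpa [G, Matrix.mul_apply, Matrix.one_apply, mul_comm] using hγ y y'
  have h2 := congrArg (fun A => A k' k) (mul_eq_one_comm.1 h)
  simpa [G, Matrix.mul_apply, Matrix.one_apply, mul_comm, eq_comm] using h2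

theorem sum_gamma_smul_refObs
    (hγ : ∀ y y' : Fin d, ∑ k, conj (gamma φ 1 y' k) * gamma φ 1 y k = if y = y' then 1 else 0)
    (k : Fin d) :
    ∑ y, gamma φ 1 y k • refObs φ 1 y = shiftX d * clockZ d ^ (k : ℕ) := by
  simp only [refObs, pow_one, Finset.smul_sum, smul_smul]
  rw [Finset.sum_comm]
  simp [← Finset.sum_smul, sum_gamma_mul_conj hγ]

theorem sum_conj_gamma_smul_tildeObs {n : ℕ}
    (hγ : ∀ y y' : Fin d, ∑ k, conj (gamma φ n y' k) * gamma φ n y k = if y = y' then 1 else 0)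
    (y : Fin d) :
    ∑ k, conj (gamma φ n y k) • tildeObs φ N n k = genObs (N y) n := by
  simp only [tildeObs, Finset.smul_sum, smul_smul]
  rw [Finset.sum_comm]
  simp [← Finset.sum_smul, hγ]

/-- Bob's observables are the transfers of the reference observables: both are the combinations
with coefficients `γ*` of the pairs `X Zᵏ`, `B̃_k`. -/
theorem transfers_refObs
    (hγ : ∀ y y' : Fin d, ∑ k, conj (gamma φ 1 y' k) * gamma φ 1 y k = if y = y' then 1 else 0)
    (h : ∀ k i ψ, tildeObs φ N 1 k (coord i (ρ ψ)) =
      ∑ j, (aliceObs d k).conjTranspose i j • coord j (ρ ψ)) (y : Fin d) :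
    Transfers ρ (refObs φ 1 y) (genObs (N y) 1) := by
  rw [← sum_conj_gamma_smul_tildeObs hγ y, refObs]
  refine Transfers.sum_smul _ _ fun k => ?_
  rw [pow_one, ← aliceObs_conjTranspose_transpose]
  exact fun i ψ => h k i ψ

/-- `X Zᵏ` is a linear combination of the unitary reference observables, so its adjoint is
transferred as well. This yields unitarity of `B̃_k` without using the terms with `n = d - 1`. -/
theorem exists_transfer_shiftX_mul_clockZ [CompleteSpace H]
    (hγ : ∀ y y' : Fin d, ∑ k, conj (gamma φ 1 y' k) * gamma φ 1 y k = if y = y' then 1 else 0)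
    (h : ∀ y, Transfers ρ (refObs φ 1 y) (genObs (N y) 1))
    (hu : ∀ y, genObs (N y) 1 ∈ unitary (H →L[ℂ] H)) (k : Fin d) :
    ∃ T, (shiftX d * clockZ d ^ (k : ℕ), T) ∈ transferAlgebra ρ := by
  refine ⟨∑ y, gamma φ 1 y k • genObs (N y) 1, ?_⟩
  rw [← sum_gamma_smul_refObs hγ, prod_mk_sum]
  exact sum_mem fun y _ => SMulMemClass.smul_mem (gamma φ 1 y k)
    (show (refObs φ 1 y, genObs (N y) 1) ∈ transferAlgebra ρ from
      ⟨h y, (h y).star_of_unitary (refObs_one_mem_unitary φ y) (Unitary.mem_iff.1 (hu y)).1⟩)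

end Rigidity

end Steering

theorem theorem2 {d : ℕ} [NeZero d] (hd : 2 ≤ d)
    {H : Type u} [NormedAddCommGroup H] [InnerProductSpace ℂ H] [CompleteSpace H]
    -- the angles, and the orthonormality imposed on the coefficients
    (φ : Fin d → Fin d → ℝ) (hφ : ∀ y, ∑ j, φ j y = 0)
    (hγ : ∀ n ∈ Finset.Icc 1 (d - 1), ∀ y y' : Fin d,
      ∑ k, conj (Steering.gamma φ n y' k) * Steering.gamma φ n y k = if y = y' then 1 else 0)
    -- the shared state (mixed in general), of which Bob's part has full support
    (ρ : (Steering.Qudit d ⊗[ℂ] H) →L[ℂ] (Steering.Qudit d ⊗[ℂ] H))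
    (hρ : Steering.IsDensityOperator ρ)
    (hsupp : ∀ v : H, Steering.bobState ρ v = 0 → v = 0)
    -- Bob's measurements, `N y b` being the effect of outcome `b` for the choice `y`
    (N : Fin d → Fin d → H →L[ℂ] H) (hN : ∀ y, Steering.IsPOVM (N y))
    -- the value `Tr (ρ 𝓢)` of the steering functional is `d (d - 1)`
    (hmax : Steering.HasTrace
      ((ρ : (Steering.Qudit d ⊗[ℂ] H) →ₗ[ℂ] (Steering.Qudit d ⊗[ℂ] H)) ∘ₗ
        Steering.steeringOp φ N) ((d : ℂ) * ((d : ℂ) - 1))) :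
    -- (i) Bob's measurements are projective
    ((∀ y b, IsStarProjection (N y b)) ∧
      ∀ n ∈ Finset.Icc 1 (d - 1), ∀ y,
        Steering.genObs (N y) n ∈ unitary (H →L[ℂ] H) ∧ Steering.genObs (N y) n ^ d = 1) ∧
    -- (ii), (iii) a unitary `U` identifies Bob's space with `ℂ^d ⊗ K`, the state with
    -- `|φ_d^+⟩⟨φ_d^+| ⊗ σ` and each `B_y` with `B̄_y ⊗ 1`
    ∃ (K : Type u) (_ : NormedAddCommGroup K) (_ : InnerProductSpace ℂ K) (_ : CompleteSpace K)
      (U : H ≃ₗᵢ[ℂ] (Steering.Qudit d ⊗[ℂ] K)) (σ : K →L[ℂ] K),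
      Steering.IsDensityOperator σ ∧
      TensorProduct.map LinearMap.id (U.toLinearEquiv : H →ₗ[ℂ] (Steering.Qudit d ⊗[ℂ] K)) ∘ₗ
          (ρ : (Steering.Qudit d ⊗[ℂ] H) →ₗ[ℂ] (Steering.Qudit d ⊗[ℂ] H)) ∘ₗ
          TensorProduct.map LinearMap.id
            (U.symm.toLinearEquiv : (Steering.Qudit d ⊗[ℂ] K) →ₗ[ℂ] H) =
        (TensorProduct.assoc ℂ (Steering.Qudit d) (Steering.Qudit d) K).conj
          (TensorProduct.map
            (InnerProductSpace.rankOne ℂ (Steering.maxEntangled d) (Steering.maxEntangled d) :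
              (Steering.Qudit d ⊗[ℂ] Steering.Qudit d) →ₗ[ℂ]
                (Steering.Qudit d ⊗[ℂ] Steering.Qudit d))
            (σ : K →ₗ[ℂ] K)) ∧
      ∀ y, (U.toLinearEquiv : H →ₗ[ℂ] (Steering.Qudit d ⊗[ℂ] K)) ∘ₗ
          (Steering.genObs (N y) 1 : H →ₗ[ℂ] H) ∘ₗ
          (U.symm.toLinearEquiv : (Steering.Qudit d ⊗[ℂ] K) →ₗ[ℂ] H) =
        TensorProduct.map (Matrix.toEuclideanLin (Steering.refObs φ 1 y)) LinearMap.id := by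

  have h1 : 1 ∈ Finset.Icc 1 (d - 1) := Finset.mem_Icc.2 ⟨le_rfl, by omega⟩
  have hrel := fun ψ => Steering.relations_of_hasTrace hd hγ hρ hN hmax ψ
  have hmul := fun y => Steering.mul_genObs_of_apply_sub_eq_zero hρ.1 hsupp
    (fun y b i ψ => (hrel ψ).2 y b i) y
  have hu := fun y => (hN y).genObs_one_mem_unitary (hmul y)
  refine ⟨⟨fun y b => (hN y).isStarProjection (hmul y) b, fun n _ y => ?_⟩, ?_⟩
  · rw [(hN y).genObs_eq_pow (hmul y)]
    refine ⟨pow_mem (hu y) n, ?_⟩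
    rw [← pow_mul, mul_comm, pow_mul, (hN y).genObs_one_pow_eq_one (hmul y), one_pow]
  · have htr := Steering.transfers_refObs (hγ 1 h1) fun k i ψ => (hrel ψ).1 k i
    choose e he using Steering.exists_transfer_single hd
      (Steering.exists_transfer_shiftX_mul_clockZ (hγ 1 h1) htr hu)
    have hE := Steering.isMatrixUnits_of_transfer hρ.1 hsupp he
    have hcoord := Steering.apply_coord_of_transfer he
    have h0 : ∀ ψ, e 0 0 (Steering.coord 0 (ρ ψ)) = Steering.coord 0 (ρ ψ) := fun ψ => by
      rw [hcoord, if_pos rfl]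
    refine ⟨Steering.corner e, inferInstance, inferInstance, Steering.completeSpace_corner e,
      hE.unitary, Steering.residualState ρ h0, ⟨Steering.isPositive_residualState hρ.1 h0,
        Steering.hasTrace_residualState hρ hE hcoord h0⟩,
      Steering.conj_unitary_state hρ.1 hE hcoord h0, fun y => ?_⟩
    rw [Steering.eq_sum_of_transfer hρ.1 hsupp he (htr y)]
    exact hE.unitary_conj _
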